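/- Let $\Omega\subset\mathbb{R}^d$ be a bounded open set (for instance a bounded domain with Lipschitz boundary). Let $B_1,\dots,B_m\subset\Omega$ be open and nonempty, and let $K_1,\dots,K_m\subset\mathbb{R}^d$ be convex sets with $B_i\subset K_i$ and $\operatorname{int}K_i\subset\Omega$ for all $i$ (in particular $K_i\subset\Omega$ is allowed), such that $\Omega\subset\bigcup_{i=1}^m\overline{K_i}$. Put $$M=\max_{x\in\Omega}|\{i : x\in K_i\}|,\qquad R=\max_{i}\operatorname{diam}(K_i),\qquad \eta=\begin{cases}1 & \text{if } B_i=K_i \text{ for all } i,\\ 3\max_{i}\frac{|K_i|}{|B_i|} & \text{otherwise,}\end{cases}$$ $$b(w,v)=\sum_{i=1}^m |B_i|\,\Bigl(\frac1{|B_i|}\int_{B_i}w\,dx\Bigr)\Bigl(\frac1{|B_i|}\int_{B_i}v\,dx\Bigr).$$ Then the following hold. 1. For every $v\in H^1(\Omega)$, $$\|v\|_{L^2(\Omega)}^2\le\eta\Bigl(\frac{R^2M}{\pi^2}\|\nabla v\|_{L^2(\Omega)}^2+b(v,v)\Bigr).$$ 2. Let $\tilde\alpha,\tilde\sigma:\Omega\to\mathbb{R}$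 be measurable with $0<\tilde\alpha_{\min}\le\tilde\alpha\le\tilde\alpha_{\max}<\infty$ and $0\le\tilde\sigma\le\tilde\sigma_{\max}<\infty$ almost everywhere on $\Omega$, where $\tilde\alpha_{\min},\tilde\alpha_{\max},\tilde\sigma_{\max}$ are constants, let $\delta>0$, and put $$\tilde c(w,v)=\int_\Omega\tilde\alpha\,\nabla w\cdot\nabla v+\tilde\sigma\,w\,v\,dx+\delta^{-1}b(w,v),\qquad \|v\|_{\tilde c}=\tilde c(v,v)^{1/2}.$$ Then, for every $v\in H^1(\Omega)$, $$\|v\|_{L^2(\Omega)}^2\le\Gamma\,\|v\|_{\tilde c}^2,\qquad \Gamma=\eta\max\Bigl\{\frac{R^2M}{\pi^2\tilde\alpha_{\min}},\,\delta\Bigr\}.$$ -/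

import Mathlib

open MeasureTheory
open scoped ContDiff

noncomputable section

namespace DataPoincare

/-- `ℝ^d` with its Euclidean norm. -/
abbrev E (d : ℕ) := EuclideanSpace ℝ (Fin d)

/-- `g` is a weak gradient of `v` on `Ω`: for every smooth `φ` with compact support in `Ω` and every
coordinate `j`, `∫_Ω v ∂_j φ = - ∫_Ω g_j φ`. -/
def IsWeakGradient {d : ℕ} (Ω : Set (E d)) (v : E d → ℝ) (g : E d → E d) : Prop :=
  ∀ φ : E d → ℝ, ContDiff ℝ ∞ φ → HasCompactSupport φ → tsupport φ ⊆ Ω →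
    ∀ j : Fin d,
      ∫ x in Ω, v x * fderiv ℝ φ x (EuclideanSpace.single j 1) = - ∫ x in Ω, g x j * φ x

/-- `v ∈ H¹(Ω)`: `v ∈ L²(Ω)` and `v` has a weak gradient in `L²(Ω)`. -/
def MemH1 {d : ℕ} (Ω : Set (E d)) (v : E d → ℝ) : Prop :=
  MemLp v 2 (volume.restrict Ω) ∧
    ∃ g : E d → E d, MemLp g 2 (volume.restrict Ω) ∧ IsWeakGradient Ω v g

open Classical in
/-- The weak gradient `∇v` of `v ∈ H¹(Ω)` (a representative; it is unique almost everywhere on `Ω`,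
see `weakGrad_ae_eq`). It is set to `0` for `v ∉ H¹(Ω)`. -/
def weakGrad {d : ℕ} (Ω : Set (E d)) (v : E d → ℝ) : E d → E d :=
  if h : ∃ g : E d → E d, MemLp g 2 (volume.restrict Ω) ∧ IsWeakGradient Ω v g
  then h.choose else 0

theorem weakGrad_spec {d : ℕ} {Ω : Set (E d)} {v : E d → ℝ} (hv : MemH1 Ω v) :
    MemLp (weakGrad Ω v) 2 (volume.restrict Ω) ∧ IsWeakGradient Ω v (weakGrad Ω v) := by
  unfold weakGrad
  rw [dif_pos hv.2]
  exact hv.2.choose_spec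

/-- Weak gradients in `L²(Ω)` are unique almost everywhere. -/
theorem weakGrad_ae_eq {d : ℕ} {Ω : Set (E d)} (hΩ : IsOpen Ω) {v : E d → ℝ} {g : E d → E d}
    (hv : MemH1 Ω v) (hg : MemLp g 2 (volume.restrict Ω)) (hvg : IsWeakGradient Ω v g) :
    weakGrad Ω v =ᵐ[volume.restrict Ω] g := by
  obtain ⟨hw, hvw⟩ := weakGrad_spec hv
  have key : ∀ j : Fin d, ∀ᵐ x ∂(volume.restrict Ω), weakGrad Ω v x j = g x j := by
    intro j
    have hpj : ∀ {f : E d → E d}, MemLp f 2 (volume.restrict Ω) →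
        LocallyIntegrable (fun x => f x j) (volume.restrict Ω) := fun hf =>
      ((EuclideanSpace.proj (𝕜 := ℝ) j).comp_memLp' hf).locallyIntegrable (by norm_num)
    have hloc : LocallyIntegrable (fun x => weakGrad Ω v x j - g x j) (volume.restrict Ω) :=
      (hpj hw).sub (hpj hg)
    rw [ae_restrict_iff' hΩ.measurableSet]
    have h0 := hΩ.ae_eq_zero_of_integral_contDiff_smul_eq_zero (μ := volume.restrict Ω)
      (f := fun x => weakGrad Ω v x j - g x j) (hloc.locallyIntegrableOn Ω) ?_
    · rw [ae_restrict_iff' hΩ.measurableSet] at h0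
      filter_upwards [h0] with x hx hxΩ
      exact sub_eq_zero.1 (hx hxΩ hxΩ)
    · intro φ h1 h2 h3
      have e1 := hvw φ h1 h2 h3 j
      have e2 := hvg φ h1 h2 h3 j
      have i1 := (hpj hw).integrable_smul_left_of_hasCompactSupport h1.continuous h2
      have i2 := (hpj hg).integrable_smul_left_of_hasCompactSupport h1.continuous h2
      simp only [smul_eq_mul, mul_sub] at i1 i2 ⊢
      rw [integral_sub i1 i2]
      simp only [mul_comm (φ _)]
      linarith
  filter_upwards [ae_all_iff.2 key] with x hx
  ext j
  exact hx j

/-- The norm of `L²(Ω)`, for scalar or vector valued functions. -/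
def l2Norm {d : ℕ} {F : Type*} [NormedAddCommGroup F] (Ω : Set (E d)) (f : E d → F) : ℝ :=
  lpNorm f 2 (volume.restrict Ω)

/-- `a(w, v) = ∫_Ω α ∇w ⬝ ∇v + σ w v dx`. -/
def aForm {d : ℕ} (Ω : Set (E d)) (α σ : E d → ℝ) (w v : E d → ℝ) : ℝ :=
  ∫ x in Ω, (α x * inner ℝ (weakGrad Ω w x) (weakGrad Ω v x) + σ x * w x * v x)

/-- `b(w, v) = ∑ i, |B i| (⨍_{B i} w) (⨍_{B i} v)`. -/
def bForm {d m : ℕ} (B : Fin m → Set (E d)) (w v : E d → ℝ) : ℝ :=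
  ∑ i, volume.real (B i) * (⨍ x in B i, w x) * (⨍ x in B i, v x)

/-- `c(w, v) = a(w, v) + δ⁻¹ b(w, v)`. -/
def cForm {d m : ℕ} (Ω : Set (E d)) (B : Fin m → Set (E d)) (α σ : E d → ℝ) (δ : ℝ)
    (w v : E d → ℝ) : ℝ :=
  aForm Ω α σ w v + δ⁻¹ * bForm B w v

/-- The semi-norm `v ↦ D(v, v)^{1/2}` induced by a form `D`. -/
def formNorm {d : ℕ} (D : (E d → ℝ) → (E d → ℝ) → ℝ) (v : E d → ℝ) : ℝ :=
  Real.sqrt (D v v)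

/-- The maximal overlap `max_{x ∈ Ω} #{i | x ∈ K i}`. -/
def overlap {d m : ℕ} (Ω : Set (E d)) (K : Fin m → Set (E d)) : ℕ :=
  ⨆ x : Ω, {i | (x : E d) ∈ K i}.ncard

/-- The maximal diameter `max_i diam (K i)`. -/
def maxDiam {d m : ℕ} (K : Fin m → Set (E d)) : ℝ :=
  ⨆ i, Metric.diam (K i)

open Classical in
/-- The mismatch `η`: `1` if `B i = K i` for all `i`, and `3 max_i |K i| / |B i|` otherwise. -/
def eta {d m : ℕ} (B K : Fin m → Set (E d)) : ℝ :=
  if ∀ i, B i = K i then 1 else 3 * ⨆ i, volume.real (K i) / volume.real (B i)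

/-- `Γ = η max {R² M / (π² α_min), δ}`. -/
def Gam {d m : ℕ} (Ω : Set (E d)) (B K : Fin m → Set (E d)) (αmin δ : ℝ) : ℝ :=
  eta B K * max (maxDiam K ^ 2 * overlap Ω K / (Real.pi ^ 2 * αmin)) δ

end DataPoincare

end

/-!
The global inequality is a sum of local ones. Each `K i` differs from its interior by a null set, so
`‖v‖²` on `Ω` is at most the sum of the `‖v‖²` on the open convex sets `interior (K i)`; summing the
local gradient terms costs the overlap `M`. On one convex set `D` the sharp Payne–Weinberger
inequality `‖v - ⨍_D v‖² ≤ (diam D / π)² ‖∇v‖²` controls the oscillation, and replacing the mean over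
`D` by the mean over `B ⊆ D` costs the factor `3 |D| / |B|`
(`DataPoincare.setIntegral_sq_le_of_subset`). The second statement follows because the energy form
dominates `α_min ‖∇v‖²`.

The Payne–Weinberger inequality is used throughout in the variance form
`|D| ∫ v² - (∫ v)² ≤ (R / π)² |D| ∫ |∇v|²`, and its proof goes from dimension one upwards.

* For a log-concave weight `e^{-V}` on an interval of length `L`, the constant `(L / π)²` comes from
  the dual problem: if `w` has weighted mean zero and `F` is the primitive of `e^{-V} w`, which
  vanishes at both ends, then `∫ e^{-V} w² = -∫ w' F`, and `∫ e^V F'² ≥ k² ∫ e^V F²` for `k < π / L`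
  by means of a solution `k cot θ - V' / 2` of a Riccati inequality
  (`sq_mul_integral_exp_neg_mul_sq_le`). The convexity of `V` enters through `V'' ≥ 0` only.
* The measure of the slices of a convex body is a log-concave function, by the Prékopa–Leindler
  inequality (`PrekopaLeindler.pi`). So the sharp inequality holds for functions `w ⟪e, x⟫` on a
  convex body (`variance_ridge_le`).
* If the inequality failed for a `C¹` function `u` on a convex body, then repeated bisection by
  hyperplanes that keep the mean value would produce convex bodies arbitrarily close to a line where
  it still fails by a fixed relative margin (`IsNeedleBody.exists_thin`). There `u` is nearly a ridge
  function, a contradiction (`variance_le_of_contDiff`).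
* For `v ∈ H¹(D)` the inequality is applied to mollifications of `v` on inner parallel sets of `D`.
  The variance is half the double integral of `(v x - v y)²`, to which Fatou's lemma applies, and
  mollification does not increase the Dirichlet energy (`variance_le_of_isWeakGradient`).
-/

section

open Set Filter Topology
open scoped ENNReal NNReal Pointwise Convolution

/-! ### Prékopa–Leindler inequality and slices of convex sets -/

/-- The one-dimensional Brunn–Minkowski inequality: translates of `A` and `B` that meet in a single
point both lie in `A + B`. -/
theorem Real.volume_add_volume_le_of_add_mem {A B C : Set ℝ} (hA : MeasurableSet A)
    (hB : MeasurableSet B) (hAne : A.Nonempty) (hBne : B.Nonempty)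
    (h : ∀ a ∈ A, ∀ b ∈ B, a + b ∈ C) : volume A + volume B ≤ volume C := by
  have compact_case : ∀ K₁ ⊆ A, ∀ K₂ ⊆ B, IsCompact K₁ → IsCompact K₂ →
      K₁.Nonempty → K₂.Nonempty → volume K₁ + volume K₂ ≤ volume C := by
    intro K₁ h1 K₂ h2 c1 c2 n1 n2
    obtain ⟨a, ha, hamax⟩ := c1.exists_isGreatest n1
    obtain ⟨b, hb, hbmin⟩ := c2.exists_isLeast n2
    have e1 : volume ((fun x => x + b) '' K₁) = volume K₁ := by
      rw [image_add_right, measure_preimage_add_right]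
    have e2 : volume ((fun x => a + x) '' K₂) = volume K₂ := by
      rw [image_add_left, measure_preimage_add]
    have hm : MeasurableSet ((fun x => a + x) '' K₂) :=
      (c2.image (by fun_prop)).measurableSet
    have hd : AEDisjoint volume ((fun x => x + b) '' K₁) ((fun x => a + x) '' K₂) := by
      refine measure_mono_null (t := {a + b}) ?_ (by simp)
      rintro z ⟨⟨x, hx, rfl⟩, ⟨y, hy, hxy⟩⟩
      have := hamax hx
      have := hbmin hy
      simp only [mem_singleton_iff] at *
      linarith
    rw [← e1, ← e2, ← measure_union₀ hm.nullMeasurableSet hd]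
    refine measure_mono ?_
    rintro z (⟨x, hx, rfl⟩ | ⟨y, hy, rfl⟩)
    · exact h _ (h1 hx) _ (h2 hb)
    · exact h _ (h1 ha) _ (h2 hy)
  obtain ⟨a, ha⟩ := hAne
  obtain ⟨b, hb⟩ := hBne
  rw [hA.measure_eq_iSup_isCompact, hB.measure_eq_iSup_isCompact]
  simp only [iSup_and']
  refine ENNReal.biSup_add_biSup_le' ⟨∅, by simp⟩ ⟨∅, by simp⟩ ?_
  rintro K₁ ⟨h1, c1⟩ K₂ ⟨h2, c2⟩
  calc volume K₁ + volume K₂ ≤ volume (insert a K₁) + volume (insert b K₂) := by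
        gcongr <;> exact subset_insert _ _
    _ ≤ volume C := compact_case _ (insert_subset ha h1) _ (insert_subset hb h2)
        (c1.insert a) (c2.insert b) (insert_nonempty _ _) (insert_nonempty _ _)

theorem ENNReal.rpow_mul_rpow_le_weighted_add {a b : ℝ} (ha : 0 < a) (hb : 0 < b) (hab : a + b = 1)
    (x y : ℝ≥0∞) : x ^ a * y ^ b ≤ ENNReal.ofReal a * x + ENNReal.ofReal b * y := by
  have hpq : (a⁻¹).HolderConjugate b⁻¹ := by
    rw [Real.holderConjugate_iff]
    constructor
    · exact (one_lt_inv₀ ha).2 (by linarith)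
    · simpa using hab
  have := ENNReal.young_inequality (x ^ a) (y ^ b) hpq
  rw [← ENNReal.rpow_mul, ← ENNReal.rpow_mul, mul_inv_cancel₀ ha.ne', mul_inv_cancel₀ hb.ne',
    ENNReal.rpow_one, ENNReal.rpow_one, ENNReal.ofReal_inv_of_pos ha, ENNReal.ofReal_inv_of_pos hb]
    at this
  simpa [div_eq_mul_inv, mul_comm] using this

/-- The layer-cake formula for a `[0, 1]`-valued function. -/
theorem lintegral_eq_lintegral_meas_lt_of_le_one {f : ℝ → ℝ≥0∞} (hf : Measurable f)
    (h1 : ∀ x, f x ≤ 1) :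
    ∫⁻ x, f x = ∫⁻ t in Ioo (0 : ℝ) 1, volume {x | ENNReal.ofReal t < f x} := by
  have hfin : ∀ x, f x ≠ ⊤ := fun x => ((h1 x).trans_lt ENNReal.one_lt_top).ne
  have e : ∀ x, f x = ENNReal.ofReal (f x).toReal := fun x => (ENNReal.ofReal_toReal (hfin x)).symm
  calc ∫⁻ x, f x = ∫⁻ x, ENNReal.ofReal (f x).toReal := lintegral_congr e
    _ = ∫⁻ t in Ioi (0 : ℝ), volume {x | t < (f x).toReal} :=
        lintegral_eq_lintegral_meas_lt volume (Eventually.of_forall fun _ => ENNReal.toReal_nonneg)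
          hf.ennreal_toReal.aemeasurable
    _ = ∫⁻ t in Ioi (0 : ℝ), (Iio (1 : ℝ)).indicator
          (fun t => volume {x | ENNReal.ofReal t < f x}) t := by
        refine setLIntegral_congr_fun measurableSet_Ioi fun t ht => ?_
        by_cases h : t < 1
        · simp only [mem_Iio, h, indicator_of_mem]
          congr 1
          ext x
          simp only [mem_ofPred_eq]
          rw [ENNReal.ofReal_lt_iff_lt_toReal (le_of_lt ht) (hfin x)]
        · simp only [mem_Iio, h, not_false_eq_true, indicator_of_notMem]
          convert measure_empty (μ := volume)
          ext x
          simp only [mem_ofPred_eq, mem_empty_iff_false, iff_false, not_lt]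
          exact (ENNReal.toReal_mono ENNReal.one_ne_top (h1 x)).trans (by simpa using h)
    _ = ∫⁻ t in Ioo (0 : ℝ) 1, volume {x | ENNReal.ofReal t < f x} := by
        rw [lintegral_indicator measurableSet_Iio, Measure.restrict_restrict measurableSet_Iio,
          inter_comm, Ioi_inter_Iio]

/-- The Prékopa–Leindler property of a measure `μ` on a real vector space:
`(∫ f)^a (∫ g)^b ≤ ∫ h` whenever `f x ^ a * g y ^ b ≤ h (a x + b y)` for all `x` and `y`. -/
def PrekopaLeindler {V : Type*} [AddCommMonoid V] [Module ℝ V] [MeasurableSpace V]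
    (μ : Measure V) : Prop :=
  ∀ (a b : ℝ), 0 < a → 0 < b → a + b = 1 → ∀ f g h : V → ℝ≥0∞,
    Measurable f → Measurable g → Measurable h →
    (∀ x y, f x ^ a * g y ^ b ≤ h (a • x + b • y)) →
    (∫⁻ x, f x ∂μ) ^ a * (∫⁻ x, g x ∂μ) ^ b ≤ ∫⁻ x, h x ∂μ

section Line

variable {a b : ℝ} {f g h : ℝ → ℝ≥0∞}

/-- For functions with supremum `1` the superlevel sets of `f` and `g` at a common height below `1`
are nonempty, and the Brunn–Minkowski inequality applies to them. -/
theorem lintegral_weighted_add_le_of_sup_eq_one (ha : 0 < a) (hb : 0 < b) (hab : a + b = 1)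
    (hf : Measurable f) (hg : Measurable g) (hh : Measurable h)
    (hfgh : ∀ x y, f x ^ a * g y ^ b ≤ h (a • x + b • y))
    (hf1 : ∀ x, f x ≤ 1) (hg1 : ∀ x, g x ≤ 1) (hfs : ∀ t < 1, ∃ x, t < f x)
    (hgs : ∀ t < 1, ∃ x, t < g x) :
    ENNReal.ofReal a * (∫⁻ x, f x) + ENNReal.ofReal b * (∫⁻ x, g x) ≤ ∫⁻ x, h x := by
  -- `h` may be cut off at `1`, since `f` and `g` do not exceed `1`
  have hk : Measurable fun x => min (h x) 1 := hh.min measurable_const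
  refine le_trans ?_ (lintegral_mono fun x => min_le_left (h x) 1)
  rw [lintegral_eq_lintegral_meas_lt_of_le_one hf hf1,
    lintegral_eq_lintegral_meas_lt_of_le_one hg hg1,
    lintegral_eq_lintegral_meas_lt_of_le_one hk fun x => min_le_right _ _]
  have anti : ∀ k : ℝ → ℝ≥0∞, Measurable fun t : ℝ => volume {x | ENNReal.ofReal t < k x} := by
    intro k
    refine Antitone.measurable fun s t hst => measure_mono fun x hx => ?_
    exact lt_of_le_of_lt (ENNReal.ofReal_le_ofReal hst) hx
  rw [← lintegral_const_mul _ (anti f), ← lintegral_const_mul _ (anti g),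
    ← lintegral_add_left ((anti f).const_mul _)]
  refine setLIntegral_mono (anti _) fun t ht => ?_
  have ht1 : ENNReal.ofReal t < 1 := by simpa using ht.2
  have scale : ∀ {c : ℝ}, 0 < c → ∀ s : Set ℝ, ENNReal.ofReal c * volume s = volume (c • s) := by
    intro c hc s
    rw [Measure.addHaar_smul]
    simp [abs_of_pos hc]
  rw [scale ha, scale hb]
  refine Real.volume_add_volume_le_of_add_mem ?_ ?_ ?_ ?_ ?_
  · exact (measurableSet_lt measurable_const hf).const_smul₀ a
  · exact (measurableSet_lt measurable_const hg).const_smul₀ b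
  · exact Set.Nonempty.smul_set (hfs _ ht1)
  · exact Set.Nonempty.smul_set (hgs _ ht1)
  · rintro _ ⟨x, hx, rfl⟩ _ ⟨y, hy, rfl⟩
    have hx : ENNReal.ofReal t < f x := hx
    have hy : ENNReal.ofReal t < g y := hy
    refine lt_min ?_ ht1
    refine lt_of_lt_of_le ?_ (hfgh x y)
    have t0 : ENNReal.ofReal t ≠ 0 := by simpa using ht.1
    calc ENNReal.ofReal t = ENNReal.ofReal t ^ a * ENNReal.ofReal t ^ b := by
          rw [← ENNReal.rpow_add _ _ t0 ENNReal.ofReal_ne_top, hab, ENNReal.rpow_one]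
      _ < f x ^ a * g y ^ b :=
          ENNReal.mul_lt_mul (ENNReal.rpow_lt_rpow hx ha) (ENNReal.rpow_lt_rpow hy hb)

/-- Normalizing both functions by their suprema turns the weighted arithmetic mean of the previous
bound into a geometric mean. -/
theorem prekopaLeindler_real_of_bounded (ha : 0 < a) (hb : 0 < b) (hab : a + b = 1)
    (hf : Measurable f) (hg : Measurable g) (hh : Measurable h)
    (hfgh : ∀ x y, f x ^ a * g y ^ b ≤ h (a • x + b • y)) {C : ℝ≥0∞} (hC : C ≠ ⊤)
    (hfC : ∀ x, f x ≤ C) (hgC : ∀ x, g x ≤ C) :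
    (∫⁻ x, f x) ^ a * (∫⁻ x, g x) ^ b ≤ ∫⁻ x, h x := by
  set A := ⨆ x, f x with hA
  set B := ⨆ x, g x with hB
  have hAt : A ≠ ⊤ := ne_top_of_le_ne_top hC (iSup_le hfC)
  have hBt : B ≠ ⊤ := ne_top_of_le_ne_top hC (iSup_le hgC)
  have hfA : ∀ x, f x ≤ A := le_iSup f
  have hgB : ∀ x, g x ≤ B := le_iSup g
  rcases eq_or_ne A 0 with hA0 | hA0
  · have : ∀ x, f x = 0 := fun x => le_antisymm ((hfA x).trans hA0.le) zero_le
    simp [this, ha]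
  rcases eq_or_ne B 0 with hB0 | hB0
  · have : ∀ x, g x = 0 := fun x => le_antisymm ((hgB x).trans hB0.le) zero_le
    simp [this, hb]
  have hH0 : A ^ a * B ^ b ≠ 0 := mul_ne_zero
    (by simp [ENNReal.rpow_eq_zero_iff, hA0, hAt]) (by simp [ENNReal.rpow_eq_zero_iff, hB0, hBt])
  have hHt : A ^ a * B ^ b ≠ ⊤ := ENNReal.mul_ne_top
    (ENNReal.rpow_ne_top_of_nonneg ha.le hAt) (ENNReal.rpow_ne_top_of_nonneg hb.le hBt)
  have sup : ∀ {k : ℝ → ℝ≥0∞} {S : ℝ≥0∞}, S = ⨆ x, k x → S ≠ 0 → S ≠ ⊤ →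
      ∀ t < 1, ∃ x, t < k x / S := by
    intro k S hS h0 ht t ht1
    have : t * S < ⨆ x, k x := by
      rw [← hS]
      calc t * S < 1 * S := by gcongr
        _ = S := one_mul _
    obtain ⟨x, hx⟩ := lt_iSup_iff.1 this
    exact ⟨x, (ENNReal.lt_div_iff_mul_lt (Or.inl h0) (Or.inl ht)).2 hx⟩
  have key := lintegral_weighted_add_le_of_sup_eq_one (f := fun x => f x / A)
    (g := fun x => g x / B) (h := fun x => h x / (A ^ a * B ^ b)) ha hb hab (hf.div_const _)
    (hg.div_const _) (hh.div_const _) ?_ (fun x => ENNReal.div_le_of_le_mul (by simpa using hfA x))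
    (fun x => ENNReal.div_le_of_le_mul (by simpa using hgB x)) (sup hA hA0 hAt) (sup hB hB0 hBt)
  · simp only [div_eq_mul_inv] at key
    rw [lintegral_mul_const _ hf, lintegral_mul_const _ hg, lintegral_mul_const _ hh] at key
    have key2 := (ENNReal.rpow_mul_rpow_le_weighted_add ha hb hab _ _).trans key
    rw [ENNReal.mul_rpow_of_nonneg _ _ ha.le, ENNReal.mul_rpow_of_nonneg _ _ hb.le,
      ENNReal.inv_rpow, ENNReal.inv_rpow, mul_mul_mul_comm,
      ← ENNReal.mul_inv (Or.inr (ENNReal.rpow_ne_top_of_nonneg hb.le hBt))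
        (Or.inl (ENNReal.rpow_ne_top_of_nonneg ha.le hAt))] at key2
    exact (ENNReal.mul_le_mul_iff_left (ENNReal.inv_ne_zero.2 hHt) (ENNReal.inv_ne_top.2 hH0)).1 key2
  · intro x y
    simp only [div_eq_mul_inv]
    rw [ENNReal.mul_rpow_of_nonneg _ _ ha.le, ENNReal.mul_rpow_of_nonneg _ _ hb.le,
      ENNReal.inv_rpow, ENNReal.inv_rpow, mul_mul_mul_comm,
      ← ENNReal.mul_inv (Or.inr (ENNReal.rpow_ne_top_of_nonneg hb.le hBt))
        (Or.inl (ENNReal.rpow_ne_top_of_nonneg ha.le hAt))]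
    gcongr
    exact hfgh x y

end Line

/-- The general case follows by truncating `f` and `g` at height `n`. -/
theorem prekopaLeindler_real : PrekopaLeindler (volume : Measure ℝ) := by
  intro a b ha hb hab f g h hf hg hh hfgh
  have trunc : ∀ {k : ℝ → ℝ≥0∞}, Measurable k →
      Tendsto (fun n : ℕ => ∫⁻ x, min (k x) n) atTop (𝓝 (∫⁻ x, k x)) := by
    intro k hk
    have hmono : Monotone fun (n : ℕ) x => min (k x) (n : ℝ≥0∞) := by
      intro m n hmn x
      exact min_le_min le_rfl (by exact_mod_cast hmn)
    have e : ∀ x, k x = ⨆ n : ℕ, min (k x) (n : ℝ≥0∞) := fun x => by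
      have := inf_iSup_eq (k x) fun n : ℕ => (n : ℝ≥0∞)
      rwa [ENNReal.iSup_natCast, inf_top_eq] at this
    rw [lintegral_congr e, lintegral_iSup (fun n => hk.min measurable_const) hmono]
    exact tendsto_atTop_iSup fun m n hmn => lintegral_mono (hmono hmn)
  rcases eq_or_ne (∫⁻ x, f x) 0 with hf0 | hf0
  · simp [hf0, ha]
  rcases eq_or_ne (∫⁻ x, g x) 0 with hg0 | hg0
  · simp [hg0, hb]
  have hlim := ENNReal.Tendsto.mul ((trunc hf).ennrpow_const a)
    (Or.inl (by simp [ENNReal.rpow_eq_zero_iff, hf0, ha.le])) ((trunc hg).ennrpow_const b)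
    (Or.inl (by simp [ENNReal.rpow_eq_zero_iff, hg0, hb.le]))
  refine le_of_tendsto' hlim fun n => ?_
  refine prekopaLeindler_real_of_bounded ha hb hab (hf.min measurable_const)
    (hg.min measurable_const) hh (fun x y => le_trans ?_ (hfgh x y)) (ENNReal.natCast_ne_top n)
    (fun x => min_le_right _ _) (fun x => min_le_right _ _)
  gcongr <;> exact min_le_left _ _

namespace PrekopaLeindler

/-- The property passes to products: it is applied to the slices, then to their integrals. -/
theorem prod {V W : Type*} [AddCommMonoid V] [Module ℝ V] [MeasurableSpace V] [AddCommMonoid W]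
    [Module ℝ W] [MeasurableSpace W] {μ : Measure V} {ν : Measure W} [SFinite ν]
    (hμ : PrekopaLeindler μ) (hν : PrekopaLeindler ν) : PrekopaLeindler (μ.prod ν) := by
  intro a b ha hb hab f g h hf hg hh hfgh
  rw [lintegral_prod _ hf.aemeasurable, lintegral_prod _ hg.aemeasurable,
    lintegral_prod _ hh.aemeasurable]
  refine hμ a b ha hb hab _ _ _ hf.lintegral_prod_right' hg.lintegral_prod_right'
    hh.lintegral_prod_right' fun x y => ?_
  exact hν a b ha hb hab _ _ _ (hf.comp measurable_prodMk_left) (hg.comp measurable_prodMk_left)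
    (hh.comp measurable_prodMk_left) fun x' y' => hfgh (x, x') (y, y')

theorem pi : ∀ n : ℕ, PrekopaLeindler (volume : Measure (Fin n → ℝ))
  | 0 => by
    intro a b ha hb hab f g h hf hg hh hfgh
    have e : (volume : Measure (Fin 0 → ℝ)) = Measure.dirac default := by
      rw [volume_pi, Measure.pi_of_empty _ default]
    simp only [e, lintegral_dirac]
    convert hfgh default default
  | n + 1 => by
    intro a b ha hb hab f g h hf hg hh hfgh
    have mp := (volume_preserving_piFinSuccAbove (fun _ : Fin (n + 1) => ℝ) 0).symm
    set e := (MeasurableEquiv.piFinSuccAbove (fun _ : Fin (n + 1) => ℝ) 0).symm with he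
    rw [← mp.lintegral_comp hf, ← mp.lintegral_comp hg, ← mp.lintegral_comp hh]
    refine prod prekopaLeindler_real (pi n) a b ha hb hab _ _ _ (hf.comp e.measurable)
      (hg.comp e.measurable) (hh.comp e.measurable) fun x y => ?_
    convert hfgh (e x) (e y)
    ext i
    refine Fin.cases ?_ (fun j => ?_) i <;> simp [he, MeasurableEquiv.piFinSuccAbove]

/-- The measure of the slices of a convex set is a log-concave function. -/
theorem measure_slice_rpow_mul_le {V W : Type*} [AddCommMonoid V] [Module ℝ V] [AddCommMonoid W]
    [Module ℝ W] [MeasurableSpace V] [MeasurableSpace W] {ν : Measure W} (hν : PrekopaLeindler ν)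
    {K : Set (V × W)} (hK : Convex ℝ K) (hKm : MeasurableSet K) {a b : ℝ} (ha : 0 < a) (hb : 0 < b)
    (hab : a + b = 1) (s t : V) :
    ν (Prod.mk s ⁻¹' K) ^ a * ν (Prod.mk t ⁻¹' K) ^ b ≤ ν (Prod.mk (a • s + b • t) ⁻¹' K) := by
  have hm : ∀ s : V, MeasurableSet (Prod.mk s ⁻¹' K) := fun s => measurable_prodMk_left hKm
  simp only [← lintegral_indicator_one (hm _)]
  refine hν a b ha hb hab _ _ _ (measurable_one.indicator (hm _)) (measurable_one.indicator (hm _))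
    (measurable_one.indicator (hm _)) fun x y => ?_
  by_cases hx : (s, x) ∈ K
  · by_cases hy : (t, y) ∈ K
    · have := hK hx hy ha.le hb.le hab
      simp only [Prod.smul_mk, Prod.mk_add_mk] at this
      simp [indicator, hx, hy, this]
    · simp [indicator, hy, hb]
  · simp [indicator, hx, ha]

end PrekopaLeindler

/-! ### Sharp weighted Poincaré inequality on an interval -/

section WeightedPoincare

variable {a b : ℝ} {V w w' : ℝ → ℝ}

/-- The pointwise form of the sharp weighted inequality, with `P = e^{-V}`, `Q = e^V`, `V1 = V'`,
`V2 = V''`, `s = sin θ` and `c = cos θ` where `θ' = k`, and `F` a primitive of `P w`. The left-hand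
side is the derivative of `F² Q y - 2 w F` for `y = k cot θ - V' / 2`, which satisfies the Riccati
inequality `(Q y)' + Q y² ≤ -k² Q` because `V'' ≥ 0`. -/
theorem riccati_pointwise {k P Q V1 V2 s c F w w' : ℝ} (hk : 0 < k) (hP : 0 < P) (hPQ : P * Q = 1)
    (hs : 0 < s) (hsc : s ^ 2 + c ^ 2 = 1) (hV2 : 0 ≤ V2) :
    2 * F * (P * w) * (Q * (k * (c / s) - V1 / 2)) +
        F ^ 2 * (Q * V1 * (k * (c / s) - V1 / 2) + Q * (-k ^ 2 / s ^ 2 - V2 / 2)) -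
      2 * (w' * F + w * (P * w)) ≤ (k ^ 2)⁻¹ * (P * w' ^ 2) - P * w ^ 2 := by
  have hQ : 0 < Q := by
    by_contra h
    nlinarith
  obtain ⟨r, hr⟩ : ∃ r, r = c / s := ⟨_, rfl⟩
  have hs2 : -k ^ 2 / s ^ 2 = -k ^ 2 * (1 + r ^ 2) := by
    rw [hr]; field_simp; rw [hsc]
  rw [hs2, ← hr]
  -- the difference of the two sides is a sum of squares
  have h1 : 0 ≤ P * (w - Q * F * (k * r - V1 / 2)) ^ 2 := by positivity
  have h2 : 0 ≤ P * (k⁻¹ * w' + k * Q * F) ^ 2 := by positivity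
  have h3 : 0 ≤ F ^ 2 * Q * (V2 / 2 + V1 ^ 2 / 4) := by positivity
  have e1 : P * (w - Q * F * (k * r - V1 / 2)) ^ 2 =
      P * w ^ 2 - 2 * w * F * (k * r - V1 / 2) + Q * F ^ 2 * (k * r - V1 / 2) ^ 2 := by
    linear_combination (-2 * w * F * (k * r - V1 / 2) + Q * F ^ 2 * (k * r - V1 / 2) ^ 2) * hPQ
  have hkk : k⁻¹ * k = 1 := inv_mul_cancel₀ hk.ne'
  have e2 : P * (k⁻¹ * w' + k * Q * F) ^ 2 =
      (k ^ 2)⁻¹ * (P * w' ^ 2) + 2 * w' * F + k ^ 2 * Q * F ^ 2 := by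
    rw [← inv_pow]
    linear_combination (2 * w' * F * k⁻¹ * k + k ^ 2 * Q * F ^ 2) * hPQ + 2 * w' * F * hkk
  have e3 : 2 * F * (P * w) * (Q * (k * r - V1 / 2)) = 2 * F * w * (k * r - V1 / 2) := by
    linear_combination 2 * F * w * (k * r - V1 / 2) * hPQ
  rw [e3]
  nlinarith [h1, h2, h3, e1, e2]

/-- The sharp Poincaré inequality on `[a, b]` for a `C²` log-concave weight `e^{-V}` and a function
of weighted mean zero, with any frequency `k` below `π / (b - a)`. -/
theorem sq_mul_integral_exp_neg_mul_sq_le {V1 V2 : ℝ → ℝ} {k : ℝ} (hab : a < b) (hk : 0 < k)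
    (hkL : k * (b - a) < Real.pi) (hV : ∀ t, HasDerivAt V (V1 t) t)
    (hV1 : ∀ t, HasDerivAt V1 (V2 t) t) (hV2 : ∀ t ∈ Icc a b, 0 ≤ V2 t)
    (hw : ∀ t, HasDerivAt w (w' t) t) (hw' : Continuous w')
    (hmean : ∫ t in a..b, Real.exp (-V t) * w t = 0) :
    k ^ 2 * ∫ t in a..b, Real.exp (-V t) * w t ^ 2 ≤ ∫ t in a..b, Real.exp (-V t) * w' t ^ 2 := by
  have cV : Continuous V := continuous_iff_continuousAt.2 fun t => (hV t).continuousAt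
  have cV1 : Continuous V1 := continuous_iff_continuousAt.2 fun t => (hV1 t).continuousAt
  have cw : Continuous w := continuous_iff_continuousAt.2 fun t => (hw t).continuousAt
  have cP : Continuous fun t => Real.exp (-V t) := by fun_prop
  set F : ℝ → ℝ := fun t => ∫ s in a..t, Real.exp (-V s) * w s with hF
  have hFd : ∀ t, HasDerivAt F (Real.exp (-V t) * w t) t := fun t =>
    (cP.mul cw).integral_hasStrictDerivAt a t |>.hasDerivAt
  have cF : Continuous F := continuous_iff_continuousAt.2 fun t => (hFd t).continuousAt
  -- the phase is shifted so that `sin θ` stays positive on the closed interval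
  set ε : ℝ := (Real.pi - k * (b - a)) / 2 with hε
  set θ : ℝ → ℝ := fun t => k * (t - a) + ε with hθ
  have hθd : ∀ t, HasDerivAt θ k t := fun t => by
    have h := (((hasDerivAt_id t).sub_const a).const_mul k).add_const ε
    rwa [mul_one] at h
  have hs : ∀ t ∈ Icc a b, 0 < Real.sin (θ t) := by
    intro t ht
    apply Real.sin_pos_of_pos_of_lt_pi
    · have : 0 ≤ k * (t - a) := mul_nonneg hk.le (by linarith [ht.1])
      simp only [hθ]; linarith
    · have : k * (t - a) ≤ k * (b - a) := by gcongr; exact ht.2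
      simp only [hθ]; linarith
  set Φ : ℝ → ℝ := fun t =>
    F t ^ 2 * (Real.exp (V t) * (k * (Real.cos (θ t) / Real.sin (θ t)) - V1 t / 2)) -
      2 * (w t * F t) with hΦ
  have key := intervalIntegral.sub_le_integral_of_hasDeriv_right_of_le (g := Φ)
    (g' := fun t => 2 * F t * (Real.exp (-V t) * w t) *
        (Real.exp (V t) * (k * (Real.cos (θ t) / Real.sin (θ t)) - V1 t / 2)) +
        F t ^ 2 * (Real.exp (V t) * V1 t * (k * (Real.cos (θ t) / Real.sin (θ t)) - V1 t / 2) +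
          Real.exp (V t) * (-k ^ 2 / Real.sin (θ t) ^ 2 - V2 t / 2)) -
        2 * (w' t * F t + w t * (Real.exp (-V t) * w t)))
    (φ := fun t => (k ^ 2)⁻¹ * (Real.exp (-V t) * w' t ^ 2) - Real.exp (-V t) * w t ^ 2)
    hab.le ?_ ?_ ?_ ?_
  · have e0 : Φ a = 0 := by simp [hΦ, hF]
    have e1 : Φ b = 0 := by simp [hΦ, hF, hmean]
    rw [e0, e1, intervalIntegral.integral_sub, intervalIntegral.integral_const_mul] at key
    · have := mul_le_mul_of_nonneg_left key (sq_nonneg k)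
      rw [sub_zero, mul_zero, mul_sub, ← mul_assoc, mul_inv_cancel₀ (by positivity), one_mul] at this
      linarith
    · exact Continuous.intervalIntegrable (by fun_prop) _ _
    · exact Continuous.intervalIntegrable (by fun_prop) _ _
  · have cθ : Continuous θ := by fun_prop
    refine ContinuousOn.sub (ContinuousOn.mul (by fun_prop) (ContinuousOn.mul (by fun_prop)
      (ContinuousOn.sub (continuousOn_const.mul (ContinuousOn.div ?_ ?_ ?_)) (by fun_prop))))
      (by fun_prop)
    · exact (Real.continuous_cos.comp cθ).continuousOn
    · exact (Real.continuous_sin.comp cθ).continuousOn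
    · exact fun t ht => (hs t ht).ne'
  · intro t ht
    have hst := (hs t (Ioo_subset_Icc_self ht)).ne'
    have hcot : HasDerivAt (fun t => Real.cos (θ t) / Real.sin (θ t))
        (-k / Real.sin (θ t) ^ 2) t := by
      refine (((Real.hasDerivAt_cos _).comp t (hθd t)).div
        ((Real.hasDerivAt_sin _).comp t (hθd t)) hst).congr_deriv ?_
      simp only [Function.comp_apply]
      rw [div_left_inj' (pow_ne_zero 2 hst)]
      linear_combination (-k) * Real.sin_sq_add_cos_sq (θ t)
    have h1 := (hFd t).pow 2 |>.mul
      ((hV t).exp.mul ((hcot.const_mul k).sub ((hV1 t).div_const 2))) |>.sub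
      (((hw t).mul (hFd t)).const_mul 2)
    refine (h1.congr_deriv ?_).hasDerivWithinAt
    simp only [Pi.mul_apply, Pi.sub_apply, Pi.pow_apply]
    ring
  · exact (Continuous.continuousOn (by fun_prop)).integrableOn_Icc
  · intro t ht
    have ht' := Ioo_subset_Icc_self ht
    exact riccati_pointwise hk (Real.exp_pos _) (by rw [← Real.exp_add]; simp) (hs t ht')
      (Real.sin_sq_add_cos_sq _) (hV2 t ht')

/-- The variance form of the previous inequality, with the sharp constant. -/
theorem variance_exp_neg_le_of_C2 {V1 V2 : ℝ → ℝ} (hab : a < b) (hV : ∀ t, HasDerivAt V (V1 t) t)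
    (hV1 : ∀ t, HasDerivAt V1 (V2 t) t) (hV2 : ∀ t ∈ Icc a b, 0 ≤ V2 t)
    (hw : ∀ t, HasDerivAt w (w' t) t) (hw' : Continuous w') :
    (∫ t in a..b, Real.exp (-V t)) * (∫ t in a..b, Real.exp (-V t) * w t ^ 2) -
        (∫ t in a..b, Real.exp (-V t) * w t) ^ 2 ≤
      (b - a) ^ 2 / Real.pi ^ 2 * ((∫ t in a..b, Real.exp (-V t)) *
        ∫ t in a..b, Real.exp (-V t) * w' t ^ 2) := by
  have cV : Continuous V := continuous_iff_continuousAt.2 fun t => (hV t).continuousAt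
  have cw : Continuous w := continuous_iff_continuousAt.2 fun t => (hw t).continuousAt
  set P0 := ∫ t in a..b, Real.exp (-V t) with hP0
  set P1 := ∫ t in a..b, Real.exp (-V t) * w t with hP1
  set P2 := ∫ t in a..b, Real.exp (-V t) * w t ^ 2 with hP2
  set D := ∫ t in a..b, Real.exp (-V t) * w' t ^ 2 with hD
  have hP0pos : 0 < P0 := intervalIntegral.intervalIntegral_pos_of_pos
    (Continuous.intervalIntegrable (by fun_prop) _ _) (fun t => Real.exp_pos _) hab
  set m := P1 / P0 with hm
  have i0 : IntervalIntegrable (fun t => Real.exp (-V t)) volume a b :=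
    Continuous.intervalIntegrable (by fun_prop) _ _
  have i1 : IntervalIntegrable (fun t => Real.exp (-V t) * w t) volume a b :=
    Continuous.intervalIntegrable (by fun_prop) _ _
  have i2 : IntervalIntegrable (fun t => Real.exp (-V t) * w t ^ 2) volume a b :=
    Continuous.intervalIntegrable (by fun_prop) _ _
  have hmean : ∫ t in a..b, Real.exp (-V t) * (w t - m) = 0 := by
    have : ∀ t, Real.exp (-V t) * (w t - m) = Real.exp (-V t) * w t - m * Real.exp (-V t) :=
      fun t => by ring
    simp only [this]
    rw [intervalIntegral.integral_sub i1 (i0.const_mul m), intervalIntegral.integral_const_mul,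
      ← hP0, ← hP1, hm, div_mul_cancel₀ _ hP0pos.ne', sub_self]
  have hsq : ∫ t in a..b, Real.exp (-V t) * (w t - m) ^ 2 = P2 - P1 ^ 2 / P0 := by
    have : ∀ t, Real.exp (-V t) * (w t - m) ^ 2 =
        Real.exp (-V t) * w t ^ 2 - 2 * m * (Real.exp (-V t) * w t) + m ^ 2 * Real.exp (-V t) :=
      fun t => by ring
    simp only [this]
    rw [intervalIntegral.integral_add (i2.sub (i1.const_mul _)) (i0.const_mul _),
      intervalIntegral.integral_sub i2 (i1.const_mul _), intervalIntegral.integral_const_mul,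
      intervalIntegral.integral_const_mul, ← hP0, ← hP1, ← hP2, hm]
    field_simp
    ring
  have hL : 0 < b - a := sub_pos.2 hab
  have hfreq : ∀ k, 0 < k → k < Real.pi / (b - a) → k ^ 2 * (P2 - P1 ^ 2 / P0) ≤ D := by
    intro k hk hkL
    rw [← hsq]
    exact sq_mul_integral_exp_neg_mul_sq_le hab hk ((lt_div_iff₀ hL).1 hkL) hV hV1 hV2
      (fun t => (hw t).sub_const m) hw' hmean
  have hlim : (Real.pi / (b - a)) ^ 2 * (P2 - P1 ^ 2 / P0) ≤ D := by
    have hc : Tendsto (fun k : ℝ => k ^ 2 * (P2 - P1 ^ 2 / P0)) (𝓝[<] (Real.pi / (b - a)))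
        (𝓝 ((Real.pi / (b - a)) ^ 2 * (P2 - P1 ^ 2 / P0))) :=
      (Continuous.tendsto (by fun_prop) _).mono_left nhdsWithin_le_nhds
    refine le_of_tendsto hc ?_
    filter_upwards [Ioo_mem_nhdsLT (div_pos Real.pi_pos hL)] with k hk
    exact hfreq k hk.1 hk.2
  have hpi := Real.pi_pos
  have h2 : P2 - P1 ^ 2 / P0 ≤ (b - a) ^ 2 / Real.pi ^ 2 * D := by
    rw [div_pow, div_mul_eq_mul_div, div_le_iff₀ (by positivity)] at hlim
    rw [div_mul_eq_mul_div, le_div_iff₀ (by positivity)]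
    linarith
  calc P0 * P2 - P1 ^ 2 = P0 * (P2 - P1 ^ 2 / P0) := by field_simp
    _ ≤ P0 * ((b - a) ^ 2 / Real.pi ^ 2 * D) := by gcongr
    _ = _ := by ring

/-- The moving average of `V` over `[t, t + ε]`. -/
noncomputable def movingAverage (ε : ℝ) (V : ℝ → ℝ) (t : ℝ) : ℝ := (∫ s in t..t + ε, V s) / ε

theorem hasDerivAt_movingAverage (hV : Continuous V) (ε t : ℝ) :
    HasDerivAt (movingAverage ε V) ((V (t + ε) - V t) / ε) t := by
  have e : movingAverage ε V = fun t => ((∫ s in (0 : ℝ)..t + ε, V s) - ∫ s in (0 : ℝ)..t, V s) / ε := by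
    ext t
    rw [movingAverage, intervalIntegral.integral_interval_sub_left (hV.intervalIntegrable _ _)
      (hV.intervalIntegrable _ _)]
  rw [e]
  have h1 : HasDerivAt (fun t => ∫ s in (0 : ℝ)..t + ε, V s) (V (t + ε)) t := by
    have := (hV.integral_hasStrictDerivAt 0 (t + ε)).hasDerivAt.comp t
      ((hasDerivAt_id t).add_const ε)
    simpa [Function.comp_def] using this
  exact (h1.sub (hV.integral_hasStrictDerivAt 0 t).hasDerivAt).div_const ε

theorem continuous_movingAverage (hV : Continuous V) (ε : ℝ) : Continuous (movingAverage ε V) :=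
  continuous_iff_continuousAt.2 fun t => (hasDerivAt_movingAverage hV ε t).continuousAt

theorem movingAverage_mem_Icc (hV : Continuous V) {ε t m M : ℝ} (hε : 0 < ε)
    (h : ∀ s ∈ Icc t (t + ε), V s ∈ Icc m M) : movingAverage ε V t ∈ Icc m M := by
  have ht : t ≤ t + ε := by linarith
  have h1 := intervalIntegral.integral_mono_on (μ := volume) ht intervalIntegrable_const
    (hV.intervalIntegrable _ _) fun s hs => (h s hs).1
  have h2 := intervalIntegral.integral_mono_on (μ := volume) ht (hV.intervalIntegrable _ _)
    intervalIntegrable_const fun s hs => (h s hs).2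
  simp only [intervalIntegral.integral_const, add_sub_cancel_left, smul_eq_mul] at h1 h2
  constructor
  · rw [movingAverage, le_div_iff₀ hε]; linarith
  · rw [movingAverage, div_le_iff₀ hε]; linarith

theorem movingAverage_movingAverage_mem_Icc (hV : Continuous V) {ε t m M : ℝ} (hε : 0 < ε)
    (h : ∀ s ∈ Icc t (t + 2 * ε), V s ∈ Icc m M) :
    movingAverage ε (movingAverage ε V) t ∈ Icc m M :=
  movingAverage_mem_Icc (continuous_movingAverage hV ε) hε fun s hs =>
    movingAverage_mem_Icc hV hε fun r hr => h r ⟨hs.1.trans hr.1, by linarith [hs.2, hr.2]⟩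

theorem tendsto_movingAverage_movingAverage (hV : Continuous V) (t : ℝ) :
    Tendsto (fun ε => movingAverage ε (movingAverage ε V) t) (𝓝[>] 0) (𝓝 (V t)) := by
  rw [Metric.tendsto_nhds]
  intro η hη
  obtain ⟨δ, hδ, h⟩ := Metric.continuous_iff.1 hV t (η / 2) (half_pos hη)
  filter_upwards [Ioo_mem_nhdsGT (half_pos hδ)] with ε hε
  have := movingAverage_movingAverage_mem_Icc (m := V t - η / 2) (M := V t + η / 2) hV hε.1
    fun s (hs : s ∈ Icc t (t + 2 * ε)) => by
      have := h s (by rw [Real.dist_eq, abs_lt]; constructor <;> linarith [hs.1, hs.2, hε.2])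
      rw [Real.dist_eq, abs_lt] at this
      constructor <;> linarith
  rw [Real.dist_eq, abs_lt]
  constructor <;> linarith [this.1, this.2]

/-- A twofold moving average is `C²`, with a second difference of `V` as second derivative. Hence the
sharp inequality holds for every convex `V`. -/
theorem variance_exp_neg_le_of_convexOn {b₀ : ℝ} (hab : a < b) (hb : b < b₀) (hV : Continuous V)
    (hconv : ConvexOn ℝ (Icc a b₀) V) (hw : ∀ t, HasDerivAt w (w' t) t) (hw' : Continuous w') :
    (∫ t in a..b, Real.exp (-V t)) * (∫ t in a..b, Real.exp (-V t) * w t ^ 2) -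
        (∫ t in a..b, Real.exp (-V t) * w t) ^ 2 ≤
      (b - a) ^ 2 / Real.pi ^ 2 * ((∫ t in a..b, Real.exp (-V t)) *
        ∫ t in a..b, Real.exp (-V t) * w' t ^ 2) := by
  have cw : Continuous w := continuous_iff_continuousAt.2 fun t => (hw t).continuousAt
  set W : ℝ → ℝ → ℝ := fun ε => movingAverage ε (movingAverage ε V) with hW
  have hsmall : Ioo 0 ((b₀ - b) / 2) ∈ 𝓝[>] (0 : ℝ) := Ioo_mem_nhdsGT (by linarith)
  obtain ⟨m, hm⟩ := (isCompact_Icc (a := a) (b := b₀)).bddBelow_image hV.continuousOn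
  have hlb : ∀ t ∈ Icc a b₀, m ≤ V t := fun t ht => hm (mem_image_of_mem V ht)
  obtain ⟨M, hM⟩ := (isCompact_Icc (a := a) (b := b₀)).bddAbove_image hV.continuousOn
  have hub : ∀ t ∈ Icc a b₀, V t ≤ M := fun t ht => hM (mem_image_of_mem V ht)
  have lim : ∀ {h : ℝ → ℝ}, Continuous h → Tendsto (fun ε => ∫ t in a..b, Real.exp (-W ε t) * h t)
      (𝓝[>] 0) (𝓝 (∫ t in a..b, Real.exp (-V t) * h t)) := by
    intro h hh
    refine intervalIntegral.tendsto_integral_filter_of_dominated_convergence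
      (fun t => Real.exp (-m) * |h t|) ?_ ?_ ?_ ?_
    · refine Eventually.of_forall fun ε => Continuous.aestronglyMeasurable ?_
      have := continuous_movingAverage (continuous_movingAverage hV ε) ε
      fun_prop
    · filter_upwards [hsmall] with ε hε
      refine Eventually.of_forall fun t ht => ?_
      rw [uIoc_of_le hab.le] at ht
      have := movingAverage_movingAverage_mem_Icc (t := t) (m := m) (M := M) hV hε.1 fun s hs => by
        have : s ∈ Icc a b₀ := ⟨ht.1.le.trans hs.1, by linarith [hs.2, ht.2, hε.2]⟩
        exact ⟨hlb s this, hub s this⟩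
      rw [norm_mul, Real.norm_eq_abs, Real.norm_eq_abs, Real.abs_exp]
      gcongr
      exact this.1
    · exact Continuous.intervalIntegrable (by fun_prop) _ _
    · refine Eventually.of_forall fun t _ => ?_
      exact ((Real.continuous_exp.tendsto _).comp
        (tendsto_movingAverage_movingAverage hV t).neg).mul_const _
  have l0 := lim (continuous_const (y := (1 : ℝ)))
  have l1 := lim cw
  have l2 := lim (cw.pow 2)
  have l3 := lim (hw'.pow 2)
  simp only [mul_one] at l0
  refine le_of_tendsto_of_tendsto ((l0.mul l2).sub (l1.pow 2)) ((l0.mul l3).const_mul _) ?_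
  filter_upwards [hsmall] with ε hε
  refine variance_exp_neg_le_of_C2
    (V1 := fun t => (movingAverage ε V (t + ε) - movingAverage ε V t) / ε)
    (V2 := fun t => ((V (t + ε + ε) - V (t + ε)) / ε - (V (t + ε) - V t) / ε) / ε) hab
    (fun t => hasDerivAt_movingAverage (continuous_movingAverage hV ε) ε t) ?_ ?_ hw hw'
  · intro t
    have h1 := (hasDerivAt_movingAverage hV ε (t + ε)).comp t ((hasDerivAt_id t).add_const ε)
    rw [mul_one] at h1
    exact (h1.sub (hasDerivAt_movingAverage hV ε t)).div_const ε
  · intro t ht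
    have hε0 := hε.1
    have ht1 : t ∈ Icc a b₀ := ⟨ht.1, by linarith [ht.2]⟩
    have ht2 : t + ε + ε ∈ Icc a b₀ := ⟨by linarith [ht.1], by linarith [ht.2, hε.2]⟩
    have h1 := hconv.2 ht1 ht2 (show (0 : ℝ) ≤ 1 / 2 by norm_num)
      (show (0 : ℝ) ≤ 1 / 2 by norm_num) (by norm_num)
    simp only [smul_eq_mul] at h1
    rw [show (1 / 2 : ℝ) * t + 1 / 2 * (t + ε + ε) = t + ε by ring] at h1
    rw [← sub_div]
    have : 0 ≤ V (t + ε + ε) - V (t + ε) - (V (t + ε) - V t) := by linarith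
    positivity

/-- The sharp Poincaré inequality, in variance form, for a weight that is positive and log-concave
on `(a, b)`. The weight may vanish or be discontinuous at the endpoints, so the interval is exhausted
from inside. -/
theorem variance_le_of_logConcave {p : ℝ → ℝ} (hab : a < b) (hpos : ∀ t ∈ Ioo a b, 0 < p t)
    (hlc : ∀ s ∈ Ioo a b, ∀ t ∈ Ioo a b, ∀ x y : ℝ, 0 < x → 0 < y → x + y = 1 →
      p s ^ x * p t ^ y ≤ p (x * s + y * t))
    (hint : IntegrableOn p (Ioo a b)) (hw : ∀ t, HasDerivAt w (w' t) t) (hw' : Continuous w') :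
    (∫ t in Ioo a b, p t) * (∫ t in Ioo a b, p t * w t ^ 2) - (∫ t in Ioo a b, p t * w t) ^ 2 ≤
      (b - a) ^ 2 / Real.pi ^ 2 * ((∫ t in Ioo a b, p t) * ∫ t in Ioo a b, p t * w' t ^ 2) := by
  have cw : Continuous w := continuous_iff_continuousAt.2 fun t => (hw t).continuousAt
  have hconv : ConvexOn ℝ (Ioo a b) fun t => -Real.log (p t) := by
    refine ⟨convex_Ioo a b, fun s hs t ht x y hx hy hxy => ?_⟩
    rcases hx.eq_or_lt with rfl | hx
    · obtain rfl : y = 1 := by linarith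
      simp
    rcases hy.eq_or_lt with rfl | hy
    · obtain rfl : x = 1 := by linarith
      simp
    have h := Real.log_le_log (by have := hpos s hs; have := hpos t ht; positivity)
      (hlc s hs t ht x y hx hy hxy)
    rw [Real.log_mul (Real.rpow_pos_of_pos (hpos s hs) _).ne'
      (Real.rpow_pos_of_pos (hpos t ht) _).ne', Real.log_rpow (hpos s hs),
      Real.log_rpow (hpos t ht)] at h
    simp only [smul_eq_mul]
    linarith
  have hcont : ContinuousOn (fun t => -Real.log (p t)) (Ioo a b) := hconv.continuousOn isOpen_Ioo
  have inner : ∀ s t, a < s → s < t → t < b →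
      (∫ r in s..t, p r) * (∫ r in s..t, p r * w r ^ 2) - (∫ r in s..t, p r * w r) ^ 2 ≤
      (b - a) ^ 2 / Real.pi ^ 2 * ((∫ r in s..t, p r) * ∫ r in s..t, p r * w' r ^ 2) := by
    intro s t hs hst ht
    -- the convex function is extended continuously from an interval reaching slightly beyond `t`
    set b₀ := (t + b) / 2 with hb₀
    have hsb : s ≤ b₀ := by linarith
    have hsub : Icc s b₀ ⊆ Ioo a b := fun r hr => ⟨by linarith [hr.1], by linarith [hr.2]⟩
    set V : ℝ → ℝ := IccExtend hsb ((Icc s b₀).domRestrict fun t => -Real.log (p t)) with hV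
    have hVe : ∀ r ∈ Icc s b₀, V r = -Real.log (p r) := fun r hr => by
      rw [hV, IccExtend_of_mem hsb _ hr]
      rfl
    have hVc : Continuous V := ((hcont.mono hsub).domRestrict).Icc_extend'
    have h := variance_exp_neg_le_of_convexOn (b₀ := b₀) hst (by linarith) hVc
      ((hconv.subset hsub (convex_Icc _ _)).congr fun r hr => (hVe r hr).symm) hw hw'
    have hp : ∀ k : ℝ → ℝ, ∫ r in s..t, Real.exp (-V r) * k r = ∫ r in s..t, p r * k r := by
      intro k
      refine intervalIntegral.integral_congr fun r hr => ?_
      rw [uIcc_of_le hst.le] at hr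
      have hr' : r ∈ Icc s b₀ := ⟨hr.1, by linarith [hr.2]⟩
      simp only [hVe r hr', neg_neg, Real.exp_log (hpos r (hsub hr'))]
    have hp0 := hp fun _ => 1
    simp only [mul_one] at hp0
    rw [hp0, hp w, hp (fun r => w r ^ 2), hp (fun r => w' r ^ 2)] at h
    refine h.trans ?_
    have n1 : 0 ≤ ∫ r in s..t, p r := intervalIntegral.integral_nonneg hst.le fun r hr =>
      (hpos r ⟨by linarith [hr.1], by linarith [hr.2]⟩).le
    have n2 : 0 ≤ ∫ r in s..t, p r * w' r ^ 2 := intervalIntegral.integral_nonneg hst.le fun r hr =>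
      mul_nonneg (hpos r ⟨by linarith [hr.1], by linarith [hr.2]⟩).le (sq_nonneg _)
    have : t - s ≤ b - a := by linarith
    have : 0 ≤ t - s := by linarith
    gcongr
  have hmul : ∀ {k : ℝ → ℝ}, Continuous k → IntegrableOn (fun t => p t * k t) (Ioo a b) := by
    intro k hk
    obtain ⟨C, hC⟩ := (isCompact_Icc (a := a) (b := b)).exists_bound_of_continuousOn hk.continuousOn
    refine Integrable.mul_bdd (c := C) hint hk.aestronglyMeasurable ?_
    filter_upwards [ae_restrict_mem measurableSet_Ioo] with t ht
    exact hC t (Ioo_subset_Icc_self ht)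
  have lim : ∀ {k : ℝ → ℝ}, IntegrableOn k (Ioo a b) →
      Tendsto (fun ε => ∫ t in a + ε..b - ε, k t) (𝓝[>] 0) (𝓝 (∫ t in Ioo a b, k t)) := by
    intro k hk
    have hA : Tendsto (fun ε => a + ε) (𝓝[>] 0) (𝓝 a) := by
      simpa using (Continuous.tendsto (f := fun ε => a + ε) (by fun_prop) 0).mono_left
        nhdsWithin_le_nhds
    have hB : Tendsto (fun ε => b - ε) (𝓝[>] 0) (𝓝 b) := by
      simpa using (Continuous.tendsto (f := fun ε => b - ε) (by fun_prop) 0).mono_left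
        nhdsWithin_le_nhds
    refine ((aecover_Ioo_of_Ioc hA hB).integral_tendsto_of_countably_generated hk).congr' ?_
    filter_upwards [Ioo_mem_nhdsGT (show (0 : ℝ) < (b - a) / 2 by linarith)] with ε hε
    rw [intervalIntegral.integral_of_le (by linarith [hε.2]),
      Measure.restrict_restrict measurableSet_Ioc]
    congr 2
    exact inter_eq_left.2 fun t ht => ⟨by linarith [ht.1, hε.1], by linarith [ht.2, hε.1]⟩
  refine le_of_tendsto_of_tendsto (((lim hint).mul (lim (hmul (cw.pow 2)))).sub
    ((lim (hmul cw)).pow 2)) (((lim hint).mul (lim (hmul (hw'.pow 2)))).const_mul _) ?_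
  filter_upwards [Ioo_mem_nhdsGT (show (0 : ℝ) < (b - a) / 2 by linarith)] with ε hε
  exact inner _ _ (by linarith [hε.1]) (by linarith [hε.2]) (by linarith [hε.1])

end WeightedPoincare

/-! ### Ridge functions on a convex body -/

section Ridge

variable {w w' : ℝ → ℝ}

/-- Integrating a function of the first coordinate over `K` amounts to a one-dimensional integral
against the measure of the slices. -/
theorem setIntegral_comp_fst_eq_integral_slice {W : Type*} [MeasurableSpace W] {ν : Measure W}
    [SFinite ν] {K : Set (ℝ × W)} (hKm : MeasurableSet K) (hfin : ∀ t, ν (Prod.mk t ⁻¹' K) ≠ ⊤)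
    {h : ℝ → ℝ} (hh : Continuous h) :
    ∫ z in K, h z.1 ∂(volume.prod ν) = ∫ t, ν.real (Prod.mk t ⁻¹' K) * h t := by
  have hq : Measurable fun t => ν (Prod.mk t ⁻¹' K) := measurable_measure_prodMk_left hKm
  have hmap : ((volume.prod ν).restrict K).map Prod.fst =
      (volume : Measure ℝ).withDensity fun t => ν (Prod.mk t ⁻¹' K) := by
    ext A hA
    rw [Measure.map_apply measurable_fst hA, Measure.restrict_apply (measurable_fst hA),
      Measure.prod_apply ((measurable_fst hA).inter hKm), withDensity_apply _ hA,
      ← lintegral_indicator hA]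
    refine lintegral_congr fun t => ?_
    by_cases ht : t ∈ A
    · simp only [ht, indicator_of_mem]
      congr 1
      ext y
      simp [ht]
    · rw [indicator_of_notMem ht]
      convert measure_empty (μ := ν)
      ext y
      simp [ht]
  rw [← integral_map (f := h) measurable_fst.aemeasurable hh.aestronglyMeasurable, hmap,
    integral_withDensity_eq_integral_toReal_smul hq (Eventually.of_forall fun t => (hfin t).lt_top)]
  rfl

/-- The sharp Poincaré inequality on a convex set for functions of the first coordinate only. -/
theorem variance_comp_fst_le {W : Type*} [AddCommMonoid W] [Module ℝ W] [MeasurableSpace W]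
    {ν : Measure W} [SFinite ν] (hν : PrekopaLeindler ν) {K : Set (ℝ × W)} (hK : Convex ℝ K)
    (hKm : MeasurableSet K) (hfin : ∀ t, ν (Prod.mk t ⁻¹' K) ≠ ⊤)
    (hKfin : (volume.prod ν) K ≠ ⊤) {R : ℝ}
    (hR : ∀ z ∈ K, ∀ z' ∈ K, z.1 - z'.1 ≤ R) (hw : ∀ t, HasDerivAt w (w' t) t)
    (hw' : Continuous w') :
    (∫ _ in K, (1 : ℝ) ∂(volume.prod ν)) * (∫ z in K, w z.1 ^ 2 ∂(volume.prod ν)) -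
        (∫ z in K, w z.1 ∂(volume.prod ν)) ^ 2 ≤
      R ^ 2 / Real.pi ^ 2 * ((∫ _ in K, (1 : ℝ) ∂(volume.prod ν)) *
        ∫ z in K, w' z.1 ^ 2 ∂(volume.prod ν)) := by
  have cw : Continuous w := continuous_iff_continuousAt.2 fun t => (hw t).continuousAt
  set p : ℝ → ℝ := fun t => ν.real (Prod.mk t ⁻¹' K) with hp
  have hslice : ∀ h : ℝ → ℝ, Continuous h →
      ∫ z in K, h z.1 ∂(volume.prod ν) = ∫ t, p t * h t := fun h hh =>
    setIntegral_comp_fst_eq_integral_slice hKm hfin hh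
  rw [hslice (fun _ => 1) continuous_const, hslice w cw, hslice (fun t => w t ^ 2) (by fun_prop),
    hslice (fun t => w' t ^ 2) (by fun_prop)]
  have hp0 : ∀ t, 0 ≤ p t := fun t => measureReal_nonneg
  have hlc : ∀ s t x y : ℝ, 0 < x → 0 < y → x + y = 1 → p s ^ x * p t ^ y ≤ p (x * s + y * t) := by
    intro s t x y hx hy hxy
    have := ENNReal.toReal_mono (hfin _) (hν.measure_slice_rpow_mul_le hK hKm hx hy hxy s t)
    rwa [ENNReal.toReal_mul, ← ENNReal.toReal_rpow, ← ENNReal.toReal_rpow] at this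
  have hint : Integrable p := by
    refine integrable_toReal_of_lintegral_ne_top (measurable_measure_prodMk_left hKm).aemeasurable ?_
    rwa [← Measure.prod_apply hKm]
  set S : Set ℝ := {t | 0 < p t} with hS
  have hconn : ∀ s ∈ S, ∀ t ∈ S, Icc s t ⊆ S := by
    have : Convex ℝ S := by
      intro s hs t ht x y hx hy hxy
      rcases hx.eq_or_lt with rfl | hx
      · obtain rfl : y = 1 := by linarith
        simpa using ht
      rcases hy.eq_or_lt with rfl | hy
      · obtain rfl : x = 1 := by linarith
        simpa using hs
      have hs : 0 < p s := hs
      have ht : 0 < p t := ht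
      exact lt_of_lt_of_le (by positivity) (hlc s t x y hx hy hxy)
    exact fun s hs t ht => this.ordConnected.out hs ht
  have hSR : ∀ s ∈ S, ∀ t ∈ S, s - t ≤ R := by
    have hne : ∀ t ∈ S, ∃ y, (t, y) ∈ K := by
      intro t ht
      by_contra! h
      have : Prod.mk t ⁻¹' K = ∅ := eq_empty_of_forall_notMem h
      have ht : 0 < ν.real (Prod.mk t ⁻¹' K) := ht
      simp [this] at ht
    intro s hs t ht
    obtain ⟨y, hy⟩ := hne s hs
    obtain ⟨z, hz⟩ := hne t ht
    exact hR _ hy _ hz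
  have hnull : (∀ᵐ t, p t = 0) → ∀ h : ℝ → ℝ, ∫ t, p t * h t = 0 := by
    intro h0 h
    refine integral_eq_zero_of_ae ?_
    filter_upwards [h0] with t ht
    simp [ht]
  -- if the slices are nonnull for at most one `t`, then every integral vanishes
  by_cases hdeg : ∀ s ∈ S, ∀ t ∈ S, s ≤ t
  · have h0 : ∀ᵐ t, p t = 0 := by
      have hsub : S.Subsingleton := fun s hs t ht => le_antisymm (hdeg s hs t ht) (hdeg t ht s hs)
      have hz : volume S = 0 := hsub.measure_zero _
      refine measure_mono_null (fun t ht => ?_) hz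
      exact lt_of_le_of_ne (hp0 t) (Ne.symm ht)
    simp only [hnull h0]
    simp
  push Not at hdeg
  obtain ⟨t₁, ht₁, t₀, ht₀, hlt⟩ := hdeg
  have hbb : BddBelow S := ⟨t₁ - R, fun t ht => by linarith [hSR _ ht₁ _ ht]⟩
  have hba : BddAbove S := ⟨t₁ + R, fun t ht => by linarith [hSR _ ht _ ht₁]⟩
  set α := sInf S
  set β := sSup S
  have hαβ : α < β := (csInf_le hbb ht₀).trans_lt (hlt.trans_le (le_csSup hba ht₁))
  have hsub1 : Ioo α β ⊆ S := by
    intro t ht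
    obtain ⟨s, hs, hst⟩ := exists_lt_of_csInf_lt ⟨t₁, ht₁⟩ ht.1
    obtain ⟨r, hr, hrt⟩ := exists_lt_of_lt_csSup ⟨t₁, ht₁⟩ ht.2
    exact hconn s hs r hr ⟨hst.le, hrt.le⟩
  have hsub2 : ∀ t, t ∉ Icc α β → p t = 0 := by
    intro t ht
    by_contra hne
    have htS : t ∈ S := lt_of_le_of_ne (hp0 t) (Ne.symm hne)
    exact ht ⟨csInf_le hbb htS, le_csSup hba htS⟩
  have hβα : β - α ≤ R := by
    have h1 : β ≤ α + R := csSup_le ⟨t₁, ht₁⟩ fun s hs => by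
      have : s - R ≤ α := le_csInf ⟨t₁, ht₁⟩ fun t ht => by linarith [hSR s hs t ht]
      linarith
    linarith
  have hred : ∀ h : ℝ → ℝ, ∫ t, p t * h t = ∫ t in Ioo α β, p t * h t := by
    intro h
    rw [← integral_Icc_eq_integral_Ioo, setIntegral_eq_integral_of_forall_compl_eq_zero]
    intro t ht
    rw [hsub2 t ht, zero_mul]
  simp only [hred]
  have key := variance_le_of_logConcave hαβ (fun t ht => hsub1 ht)
    (fun s _ t _ x y hx hy hxy => hlc s t x y hx hy hxy) hint.integrableOn hw hw'
  simp only [mul_one]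
  refine key.trans ?_
  have : 0 ≤ ∫ t in Ioo α β, p t := integral_nonneg hp0
  have : 0 ≤ ∫ t in Ioo α β, p t * w' t ^ 2 :=
    integral_nonneg fun t => mul_nonneg (hp0 t) (sq_nonneg _)
  have : 0 ≤ β - α := by linarith
  gcongr

/-- The sharp Poincaré inequality on a convex body for ridge functions `x ↦ w ⟪e, x⟫`. -/
theorem variance_ridge_le {d : ℕ} {K : Set (EuclideanSpace ℝ (Fin d))} (hKc : IsCompact K)
    (hK : Convex ℝ K) {R : ℝ} (hR : Metric.diam K ≤ R) {e : EuclideanSpace ℝ (Fin d)}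
    (he : ‖e‖ = 1) (hw : ∀ t, HasDerivAt w (w' t) t) (hw' : Continuous w') :
    (∫ _ in K, (1 : ℝ)) * (∫ x in K, w (inner ℝ e x) ^ 2) - (∫ x in K, w (inner ℝ e x)) ^ 2 ≤
      R ^ 2 / Real.pi ^ 2 * ((∫ _ in K, (1 : ℝ)) * ∫ x in K, w' (inner ℝ e x) ^ 2) := by
  obtain _ | n := d
  · have : e = 0 := Subsingleton.elim _ _
    simp [this] at he
  obtain ⟨B, hB⟩ := Orthonormal.exists_orthonormalBasis_extension_of_card_eq (𝕜 := ℝ)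
    (E := EuclideanSpace ℝ (Fin (n + 1))) (ι := Fin (n + 1)) (by simp) (v := fun _ => e) (s := {0})
    (by
      rw [orthonormal_iff_ite]
      rintro ⟨i, hi⟩ ⟨j, hj⟩
      obtain rfl := hi
      obtain rfl := hj
      simp [he])
  have hB0 : B 0 = e := hB 0 rfl
  -- orthonormal coordinates whose first coordinate is `⟪e, x⟫`
  set T : EuclideanSpace ℝ (Fin (n + 1)) ≃ᵐ ℝ × (Fin n → ℝ) :=
    (B.measurableEquiv.trans (MeasurableEquiv.toLp 2 (Fin (n + 1) → ℝ)).symm).trans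
      (MeasurableEquiv.piFinSuccAbove (fun _ => ℝ) 0) with hT
  have hTmp : MeasurePreserving T volume (volume.prod volume) :=
    (volume_preserving_piFinSuccAbove (fun _ : Fin (n + 1) => ℝ) 0).comp
      ((EuclideanSpace.volume_preserving_symm_measurableEquiv_toLp (Fin (n + 1))).comp
        B.measurePreserving_measurableEquiv)
  have hT1 : ∀ x, (T x).1 = inner ℝ e x := by
    intro x
    simp [hT, MeasurableEquiv.piFinSuccAbove, OrthonormalBasis.measurableEquiv,
      OrthonormalBasis.repr_apply_apply, hB0]
  have hTlin : IsLinearMap ℝ T := by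
    constructor
    · intro x y
      ext i
      · simp [hT1, inner_add_right]
      · simp [hT, MeasurableEquiv.piFinSuccAbove, OrthonormalBasis.measurableEquiv, Fin.tail]
    · intro c x
      ext i
      · simp [hT1, inner_smul_right]
      · simp [hT, MeasurableEquiv.piFinSuccAbove, OrthonormalBasis.measurableEquiv, Fin.tail]
  have hTcont : Continuous T := (IsLinearMap.mk' T hTlin).continuous_of_finiteDimensional
  have hKT : IsCompact (T '' K) := hKc.image hTcont
  have htrans : ∀ h : ℝ → ℝ, ∫ z in T '' K, h z.1 ∂(volume.prod volume) =
      ∫ x in K, h (inner ℝ e x) := by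
    intro h
    rw [← hTmp.setIntegral_preimage_emb T.measurableEmbedding, preimage_image_eq _ T.injective]
    simp only [hT1]
  have key := variance_comp_fst_le (PrekopaLeindler.pi n) (hK.is_linear_image hTlin)
    hKT.measurableSet (fun t => ?_) hKT.measure_ne_top (R := R) ?_ hw hw'
  · rw [htrans fun _ => 1, htrans w, htrans fun t => w t ^ 2, htrans fun t => w' t ^ 2] at key
    exact key
  · refine ne_top_of_le_ne_top (hKT.image continuous_snd).measure_ne_top
      (measure_mono (t := Prod.snd '' (T '' K)) fun y hy => ⟨(t, y), hy, rfl⟩)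
  · rintro _ ⟨x, hx, rfl⟩ _ ⟨y, hy, rfl⟩
    rw [hT1, hT1, ← inner_sub_right]
    calc inner ℝ e (x - y) ≤ ‖e‖ * ‖x - y‖ := real_inner_le_norm _ _
      _ = dist x y := by rw [he, one_mul, dist_eq_norm]
      _ ≤ R := (Metric.dist_le_diam_of_mem hKc.isBounded hx hy).trans hR

end Ridge

/-! ### Localization to thin convex bodies -/

section Localization

variable {d : ℕ} {f g : EuclideanSpace ℝ (Fin d) → ℝ} {K : Set (EuclideanSpace ℝ (Fin d))}

/-- The affine function `x ↦ cos θ (x i - r) + sin θ (x j - s)`; its zero sets are the hyperplanes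
that contain the codimension-two plane `x i = r`, `x j = s`. -/
noncomputable def pencil (i j : Fin d) (r s θ : ℝ) (x : EuclideanSpace ℝ (Fin d)) : ℝ :=
  Real.cos θ * (x i - r) + Real.sin θ * (x j - s)

theorem continuous_pencil (i j : Fin d) (r s θ : ℝ) : Continuous (pencil i j r s θ) := by
  unfold pencil
  fun_prop

theorem convex_pencil_nonpos (i j : Fin d) (r s θ : ℝ) : Convex ℝ {x | pencil i j r s θ x ≤ 0} := by
  intro x hx y hy a b ha hb hab
  simp only [mem_ofPred_eq, pencil, PiLp.add_apply, PiLp.smul_apply, smul_eq_mul] at *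
  obtain rfl : b = 1 - a := by linarith
  nlinarith [mul_nonneg ha (neg_nonneg.2 hx), mul_nonneg hb (neg_nonneg.2 hy)]

theorem pencil_add_pi (i j : Fin d) (r s θ : ℝ) (x : EuclideanSpace ℝ (Fin d)) :
    pencil i j r s (θ + Real.pi) x = -pencil i j r s θ x := by
  simp only [pencil, Real.cos_add_pi, Real.sin_add_pi]
  ring

theorem volume_pencil_eq_zero {i j : Fin d} (hij : i ≠ j) (r s θ : ℝ) :
    volume {x | pencil i j r s θ x = 0} = 0 := by
  rcases eq_empty_or_nonempty {x | pencil i j r s θ x = 0} with h | ⟨p, hp⟩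
  · rw [h, measure_empty]
  let L : EuclideanSpace ℝ (Fin d) →ₗ[ℝ] ℝ :=
    Real.cos θ • (EuclideanSpace.proj i : _ →L[ℝ] ℝ).toLinearMap +
      Real.sin θ • (EuclideanSpace.proj j : _ →L[ℝ] ℝ).toLinearMap
  have hL : ∀ x, L x = Real.cos θ * x i + Real.sin θ * x j := fun x => by simp [L]
  have hset : {x | pencil i j r s θ x = 0} ⊆ (AffineSubspace.mk' p (LinearMap.ker L) : Set _) := by
    intro x hx
    have hx : pencil i j r s θ x = 0 := hx
    have hp : pencil i j r s θ p = 0 := hp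
    simp only [SetLike.mem_coe, AffineSubspace.mem_mk', LinearMap.mem_ker, vsub_eq_sub, hL, PiLp.sub_apply]
    simp only [pencil] at hx hp
    linarith
  refine measure_mono_null hset (Measure.addHaar_affineSubspace _ _ fun htop => ?_)
  have hker : ∀ x, L x = 0 := by
    intro x
    have : x + p ∈ AffineSubspace.mk' p (LinearMap.ker L) := htop ▸ AffineSubspace.mem_top ℝ _ _
    simpa using this
  have h1 := hker (EuclideanSpace.single i 1)
  have h2 := hker (EuclideanSpace.single j 1)
  simp only [hL, PiLp.single_apply, hij, hij.symm, if_true, if_false] at h1 h2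
  have := Real.sin_sq_add_cos_sq θ
  simp at h1 h2
  simp [h1, h2] at this

theorem setIntegral_pencil_add {i j : Fin d} (hij : i ≠ j) (r s θ : ℝ) (hK : IsCompact K)
    (hf : Continuous f) :
    (∫ x in K ∩ {x | pencil i j r s θ x ≤ 0}, f x) +
      ∫ x in K ∩ {x | pencil i j r s (θ + Real.pi) x ≤ 0}, f x = ∫ x in K, f x := by
  have hfK : IntegrableOn f K := hf.continuousOn.integrableOn_compact hK
  have hm : ∀ θ, MeasurableSet (K ∩ {x | pencil i j r s θ x ≤ 0}) := fun θ =>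
    hK.measurableSet.inter (measurableSet_le (continuous_pencil i j r s θ).measurable
      measurable_const)
  rw [← setIntegral_union₀ _ (hm _).nullMeasurableSet (hfK.mono_set inter_subset_left)
    (hfK.mono_set inter_subset_left)]
  · congr 2
    rw [← inter_union_distrib_left]
    refine inter_eq_left.2 fun x _ => ?_
    simp only [mem_union, mem_ofPred_eq, pencil_add_pi]
    rcases le_total (pencil i j r s θ x) 0 with h | h
    · exact Or.inl h
    · exact Or.inr (by linarith)
  · refine measure_mono_null (fun x hx => ?_) (volume_pencil_eq_zero hij r s θ)
    have h1 : pencil i j r s θ x ≤ 0 := hx.1.2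
    have h2 : pencil i j r s (θ + Real.pi) x ≤ 0 := hx.2.2
    rw [pencil_add_pi] at h2
    exact le_antisymm h1 (by linarith)

theorem continuous_setIntegral_pencil {i j : Fin d} (hij : i ≠ j) (r s : ℝ) (hK : IsCompact K)
    (hg : Continuous g) :
    Continuous fun θ => ∫ x in K ∩ {x | pencil i j r s θ x ≤ 0}, g x := by
  have hgK : IntegrableOn g K := hg.continuousOn.integrableOn_compact hK
  have hm : ∀ θ, MeasurableSet {x | pencil i j r s θ x ≤ 0} := fun θ =>
    measurableSet_le (continuous_pencil i j r s θ).measurable measurable_const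
  have e : (fun θ => ∫ x in K ∩ {x | pencil i j r s θ x ≤ 0}, g x) =
      fun θ => ∫ x in K, {x | pencil i j r s θ x ≤ 0}.indicator g x := by
    ext θ
    rw [integral_indicator (hm θ), Measure.restrict_restrict (hm θ), inter_comm]
  rw [e, continuous_iff_continuousAt]
  intro θ
  refine continuousAt_of_dominated (bound := fun x => ‖g x‖) ?_ ?_ hgK.norm ?_
  · exact Eventually.of_forall fun θ => (hgK.aestronglyMeasurable.indicator (hm θ))
  · exact Eventually.of_forall fun θ => Eventually.of_forall fun x => norm_indicator_le_norm_self _ _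
  · have hn : ∀ᵐ x ∂(volume.restrict K), pencil i j r s θ x ≠ 0 :=
      ae_restrict_of_ae (measure_eq_zero_iff_ae_notMem.1 (volume_pencil_eq_zero hij r s θ))
    filter_upwards [hn] with x hx
    have hc : Continuous fun θ => pencil i j r s θ x := by unfold pencil; fun_prop
    rcases lt_or_gt_of_ne hx with h | h
    · have : (fun θ => {x | pencil i j r s θ x ≤ 0}.indicator g x) =ᶠ[𝓝 θ] fun _ => g x := by
        filter_upwards [hc.continuousAt.eventually_lt continuousAt_const h] with θ' h'
        exact indicator_of_mem (s := {x | pencil i j r s θ' x ≤ 0}) (le_of_lt h') g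
      exact continuousAt_const.congr this.symm
    · have : (fun θ => {x | pencil i j r s θ x ≤ 0}.indicator g x) =ᶠ[𝓝 θ] fun _ => 0 := by
        filter_upwards [continuousAt_const.eventually_lt hc.continuousAt h] with θ' h'
        exact indicator_of_notMem (s := {x | pencil i j r s θ' x ≤ 0}) (not_le.2 h') g
      exact continuousAt_const.congr this.symm

/-- The state of the bisection: a convex body on which `g` has mean zero and `f` has a positive
integral. -/
structure IsNeedleBody (g f : EuclideanSpace ℝ (Fin d) → ℝ) (K : Set (EuclideanSpace ℝ (Fin d))) :
    Prop where
  isCompact : IsCompact K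
  convex : Convex ℝ K
  integral_eq_zero : ∫ x in K, g x = 0
  integral_pos : 0 < ∫ x in K, f x

namespace IsNeedleBody

/-- A hyperplane through a given codimension-two plane halves the body so that `g` has mean zero on
both sides: turning it by the angle `π` changes the sign of the integral of `g` over its negative side.
One of the two halves keeps a positive integral of `f`. -/
theorem exists_subset_halfspace (h : IsNeedleBody g f K) (hg : Continuous g) (hf : Continuous f)
    {i j : Fin d} (hij : i ≠ j) (r s : ℝ) :
    ∃ K' ⊆ K, IsNeedleBody g f K' ∧ ∃ θ, ∀ x ∈ K', pencil i j r s θ x ≤ 0 := by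
  set G : ℝ → ℝ := fun θ => ∫ x in K ∩ {x | pencil i j r s θ x ≤ 0}, g x with hG
  have hGadd : ∀ θ, G θ + G (θ + Real.pi) = 0 := fun θ => by
    refine Eq.trans ?_ h.integral_eq_zero
    exact setIntegral_pencil_add hij r s θ h.isCompact hg
  obtain ⟨θ, -, hθ⟩ : (0 : ℝ) ∈ G '' uIcc 0 Real.pi := by
    refine intermediate_value_uIcc
      (continuous_setIntegral_pencil hij r s h.isCompact hg).continuousOn ?_
    have := hGadd 0
    rw [zero_add] at this
    rw [mem_uIcc]
    rcases le_total (G 0) 0 with h0 | h0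
    · exact Or.inl ⟨h0, by linarith⟩
    · exact Or.inr ⟨by linarith, h0⟩
  have body : ∀ θ, G θ = 0 → 0 < ∫ x in K ∩ {x | pencil i j r s θ x ≤ 0}, f x →
      ∃ K' ⊆ K, IsNeedleBody g f K' ∧ ∃ θ, ∀ x ∈ K', pencil i j r s θ x ≤ 0 := fun θ h0 hpos =>
    ⟨_, inter_subset_left, ⟨h.isCompact.inter_right
      (isClosed_le (continuous_pencil i j r s θ) continuous_const),
      h.convex.inter (convex_pencil_nonpos i j r s θ), h0, hpos⟩, θ, fun x hx => hx.2⟩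
  have hsum := setIntegral_pencil_add hij r s θ h.isCompact hf
  by_cases hp : 0 < ∫ x in K ∩ {x | pencil i j r s θ x ≤ 0}, f x
  · exact body θ hθ hp
  · refine body (θ + Real.pi) (by linarith [hGadd θ]) ?_
    linarith [h.integral_pos]

/-- Iterated bisection, with every codimension-two coordinate plane with rational data used at some
stage. -/
theorem exists_antitone_seq [NeZero d] (h : IsNeedleBody g f K) (hg : Continuous g)
    (hf : Continuous f) :
    ∃ S : ℕ → Set (EuclideanSpace ℝ (Fin d)), Antitone S ∧ S 0 = K ∧ (∀ n, IsNeedleBody g f (S n)) ∧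
      ∀ i j : Fin d, i ≠ j → ∀ r s : ℚ, ∃ n θ, ∀ x ∈ S n, pencil i j r s θ x ≤ 0 := by
  obtain ⟨q, hq⟩ := exists_surjective_nat (Fin d × Fin d × ℚ × ℚ)
  have step : ∀ (n : ℕ) (T : {T // IsNeedleBody g f T}), ∃ T' : {T // IsNeedleBody g f T},
      T'.1 ⊆ T.1 ∧ ((q n).1 ≠ (q n).2.1 → ∃ θ, ∀ x ∈ T'.1,
        pencil (q n).1 (q n).2.1 (q n).2.2.1 (q n).2.2.2 θ x ≤ 0) := by
    intro n T
    by_cases hij : (q n).1 = (q n).2.1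
    · exact ⟨T, Subset.rfl, fun hne => absurd hij hne⟩
    · obtain ⟨K', hK', hb, hθ⟩ := T.2.exists_subset_halfspace hg hf hij (q n).2.2.1 (q n).2.2.2
      exact ⟨⟨K', hb⟩, hK', fun _ => hθ⟩
  choose next hsub hhalf using step
  let S : ℕ → {T // IsNeedleBody g f T} := fun n => Nat.rec ⟨K, h⟩ next n
  have hS : ∀ n, S (n + 1) = next n (S n) := fun n => rfl
  refine ⟨fun n => (S n).1, antitone_nat_of_succ_le fun n => ?_, rfl, fun n => (S n).2, ?_⟩
  · rw [hS]
    exact hsub n (S n)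
  · intro i j hij r s
    obtain ⟨n, hn⟩ := hq (i, j, r, s)
    refine ⟨n + 1, ?_⟩
    have := hhalf n (S n)
    rw [hn] at this
    exact this hij

end IsNeedleBody

/-- A set that is kept on one side of some hyperplane through every rational codimension-two
coordinate plane has no three affinely independent points: the projection of their triangle to a
coordinate plane would contain a rational point in its interior. -/
theorem minor_eq_zero_of_pencil_nonpos {C : Set (EuclideanSpace ℝ (Fin d))}
    (hC : ∀ i j : Fin d, i ≠ j → ∀ r s : ℚ, ∃ θ, ∀ x ∈ C, pencil i j r s θ x ≤ 0)
    {x y z : EuclideanSpace ℝ (Fin d)} (hx : x ∈ C) (hy : y ∈ C) (hz : z ∈ C) (i j : Fin d) :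
    (y i - x i) * (z j - x j) - (y j - x j) * (z i - x i) = 0 := by
  by_contra hΔ
  have hij : i ≠ j := by
    rintro rfl
    exact hΔ (by ring)
  set u₁ := y i - x i
  set u₂ := y j - x j
  set v₁ := z i - x i
  set v₂ := z j - x j
  set Δ := u₁ * v₂ - u₂ * v₁ with hΔd
  -- barycentric coordinates in the projected triangle, by Cramer's rule
  set β : ℝ × ℝ → ℝ := fun p => ((p.1 - x i) * v₂ - (p.2 - x j) * v₁) / Δ with hβ
  set γ : ℝ × ℝ → ℝ := fun p => (u₁ * (p.2 - x j) - u₂ * (p.1 - x i)) / Δ with hγ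
  have cβ : Continuous β := by fun_prop
  have cγ : Continuous γ := by fun_prop
  have hopen : IsOpen {p | 0 < β p ∧ 0 < γ p ∧ β p + γ p < 1} :=
    (isOpen_lt continuous_const cβ).inter ((isOpen_lt continuous_const cγ).inter
      (isOpen_lt (cβ.add cγ) continuous_const))
  have hne : ({p | 0 < β p ∧ 0 < γ p ∧ β p + γ p < 1}).Nonempty := by
    refine ⟨(x i + u₁ / 3 + v₁ / 3, x j + u₂ / 3 + v₂ / 3), ?_⟩
    have e1 : β (x i + u₁ / 3 + v₁ / 3, x j + u₂ / 3 + v₂ / 3) = 1 / 3 := by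
      rw [hβ, div_eq_iff hΔ, hΔd]; ring
    have e2 : γ (x i + u₁ / 3 + v₁ / 3, x j + u₂ / 3 + v₂ / 3) = 1 / 3 := by
      rw [hγ, div_eq_iff hΔ, hΔd]; ring
    simp only [mem_ofPred_eq, e1, e2]
    norm_num
  obtain ⟨⟨r, s⟩, h1, h2, h3⟩ := ((Rat.denseRange_cast (𝕜 := ℝ)).prodMap
    (Rat.denseRange_cast (𝕜 := ℝ))).exists_mem_open hopen hne
  obtain ⟨θ, hθ⟩ := hC i j hij r s
  simp only [Prod.map_apply] at h1 h2 h3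
  have hb : β (r, s) * Δ = ((r : ℝ) - x i) * v₂ - (s - x j) * v₁ := div_mul_cancel₀ _ hΔ
  have hc : γ (r, s) * Δ = u₁ * ((s : ℝ) - x j) - u₂ * (r - x i) := div_mul_cancel₀ _ hΔ
  set b := β (r, s)
  set c := γ (r, s)
  have er : (r : ℝ) = x i + b * u₁ + c * v₁ := by
    apply mul_right_cancel₀ hΔ
    linear_combination -u₁ * hb - v₁ * hc + ((r : ℝ) - x i) * hΔd
  have es : (s : ℝ) = x j + b * u₂ + c * v₂ := by
    apply mul_right_cancel₀ hΔ
    linear_combination -u₂ * hb - v₂ * hc + ((s : ℝ) - x j) * hΔd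
  have px := hθ x hx
  have py := hθ y hy
  have pz := hθ z hz
  set A := pencil i j r s θ x with hA
  set U := Real.cos θ * u₁ + Real.sin θ * u₂ with hU
  set W := Real.cos θ * v₁ + Real.sin θ * v₂ with hW
  have ey : pencil i j r s θ y = A + U := by simp only [hA, hU, pencil, u₁, u₂]; ring
  have ez : pencil i j r s θ z = A + W := by simp only [hA, hW, pencil, v₁, v₂]; ring
  have e0 : A + b * U + c * W = 0 := by
    simp only [hA, hU, hW, pencil]; rw [er, es]; ring
  rw [ey] at py
  rw [ez] at pz
  have t1 : (1 - b - c) * A ≤ 0 := mul_nonpos_of_nonneg_of_nonpos (by linarith) px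
  have t2 : b * (A + U) ≤ 0 := mul_nonpos_of_nonneg_of_nonpos h1.le py
  have t3 : c * (A + W) ≤ 0 := mul_nonpos_of_nonneg_of_nonpos h2.le pz
  have t0 : (1 - b - c) * A + b * (A + U) + c * (A + W) = 0 := by rw [← e0]; ring
  have hA0 : A = 0 := (mul_eq_zero.1 (by linarith : (1 - b - c) * A = 0)).resolve_left (by linarith)
  have hU0 : U = 0 := by
    linarith [(mul_eq_zero.1 (by linarith : b * (A + U) = 0)).resolve_left h1.ne']
  have hW0 : W = 0 := by
    linarith [(mul_eq_zero.1 (by linarith : c * (A + W) = 0)).resolve_left h2.ne']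
  have hcos : Real.cos θ = 0 := by
    have : Real.cos θ * Δ = 0 := by
      linear_combination v₂ * hU0 - u₂ * hW0 - v₂ * hU + u₂ * hW + Real.cos θ * hΔd
    exact (mul_eq_zero.1 this).resolve_right hΔ
  have hsin : Real.sin θ = 0 := by
    have : Real.sin θ * Δ = 0 := by
      linear_combination u₁ * hW0 - v₁ * hU0 - u₁ * hW + v₁ * hU + Real.sin θ * hΔd
    exact (mul_eq_zero.1 this).resolve_right hΔ
  have := Real.sin_sq_add_cos_sq θ
  simp [hcos, hsin] at this

/-- The localization principle: inside a needle body there are needle bodies that are arbitrarily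
close to a line. -/
theorem IsNeedleBody.exists_thin [NeZero d] (h : IsNeedleBody g f K) (hg : Continuous g)
    (hf : Continuous f) {δ : ℝ} (hδ : 0 < δ) :
    ∃ K' ⊆ K, IsNeedleBody g f K' ∧ ∃ y e : EuclideanSpace ℝ (Fin d), ‖e‖ = 1 ∧
      ∀ x ∈ K', ‖x - (y + inner ℝ e x • e)‖ < δ := by
  obtain ⟨S, hanti, hS0, hS, hhalf⟩ := h.exists_antitone_seq hg hf
  have hne : ∀ n, (S n).Nonempty := by
    intro n
    by_contra hempty
    have := (hS n).integral_pos
    simp [not_nonempty_iff_eq_empty.1 hempty] at this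
  obtain ⟨x₀, hx₀⟩ : (⋂ n, S n).Nonempty :=
    IsCompact.nonempty_iInter_of_directed_nonempty_isCompact_isClosed S hanti.directed_ge hne
      (fun n => (hS n).isCompact) fun n => (hS n).isCompact.isClosed
  have hC : ∀ i j : Fin d, i ≠ j → ∀ r s : ℚ, ∃ θ, ∀ x ∈ ⋂ n, S n, pencil i j r s θ x ≤ 0 := by
    intro i j hij r s
    obtain ⟨n, θ, hn⟩ := hhalf i j hij r s
    exact ⟨θ, fun x hx => hn x (mem_iInter.1 hx n)⟩
  obtain ⟨e, he, hline⟩ : ∃ e : EuclideanSpace ℝ (Fin d), ‖e‖ = 1 ∧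
      ∀ x ∈ ⋂ n, S n, ∃ c : ℝ, x - x₀ = c • e := by
    by_cases hy : ∃ y ∈ ⋂ n, S n, y ≠ x₀
    · obtain ⟨y, hyC, hyx⟩ := hy
      have hn : ‖y - x₀‖ ≠ 0 := norm_ne_zero_iff.2 (sub_ne_zero.2 hyx)
      refine ⟨‖y - x₀‖⁻¹ • (y - x₀), by rw [norm_smul, norm_inv, norm_norm, inv_mul_cancel₀ hn], ?_⟩
      intro z hz
      obtain ⟨i, hi⟩ : ∃ i, y i - x₀ i ≠ 0 := by
        by_contra! hall
        exact hyx (by ext i; linarith [hall i])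
      refine ⟨(z i - x₀ i) / (y i - x₀ i) * ‖y - x₀‖, ?_⟩
      rw [smul_smul, mul_assoc, mul_inv_cancel₀ hn, mul_one]
      ext j
      have := minor_eq_zero_of_pencil_nonpos hC hx₀ hyC hz i j
      simp only [PiLp.sub_apply, PiLp.smul_apply, smul_eq_mul]
      field_simp
      linarith
    · push Not at hy
      refine ⟨EuclideanSpace.single 0 1, by simp, fun x hx => ⟨0, ?_⟩⟩
      rw [hy x hx, sub_self, zero_smul]
  set y := x₀ - (inner ℝ e x₀ : ℝ) • e with hy
  have hU : IsOpen {x | ‖x - (y + inner ℝ e x • e)‖ < δ} := isOpen_lt (by fun_prop) continuous_const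
  obtain ⟨n, hn⟩ := exists_subset_nhds_of_isCompact' hanti.directed_ge
    (fun n => (hS n).isCompact) (fun n => (hS n).isCompact.isClosed)
    (U := {x | ‖x - (y + inner ℝ e x • e)‖ < δ}) fun x hx => hU.mem_nhds (by
      obtain ⟨c, hc⟩ := hline x hx
      obtain rfl : x = x₀ + c • e := by rw [← hc]; abel
      have : x₀ + c • e - (y + inner ℝ e (x₀ + c • e) • e) = 0 := by
        rw [inner_add_right, inner_smul_right, real_inner_self_eq_norm_sq, he, hy, add_smul,
          one_pow, mul_one]
        abel
      simp only [mem_ofPred_eq]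
      rwa [this, norm_zero])
  exact ⟨S n, hS0 ▸ hanti (Nat.zero_le n), hS n, y, e, he, hn⟩

end Localization

/-! ### Payne–Weinberger inequality for smooth functions -/

/-- The Payne–Weinberger inequality for `C¹` functions on a convex body, in variance form. If it
failed, it would fail by a definite margin on a convex body so close to a line that `u` is nearly a
ridge function there, contrary to the inequality for ridge functions. -/
theorem variance_le_of_contDiff {d : ℕ} {K : Set (EuclideanSpace ℝ (Fin d))} (hKc : IsCompact K)
    (hK : Convex ℝ K) {R : ℝ} (hR : Metric.diam K ≤ R) {u : EuclideanSpace ℝ (Fin d) → ℝ}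
    (hu : ContDiff ℝ 1 u) (hsupp : HasCompactSupport u) :
    (∫ _ in K, (1 : ℝ)) * (∫ x in K, u x ^ 2) - (∫ x in K, u x) ^ 2 ≤
      R ^ 2 / Real.pi ^ 2 * ((∫ _ in K, (1 : ℝ)) * ∫ x in K, ‖fderiv ℝ u x‖ ^ 2) := by
  set C := R ^ 2 / Real.pi ^ 2 with hC
  have hC0 : 0 ≤ C := by positivity
  have cu : Continuous u := hu.continuous
  have cDu : Continuous (fderiv ℝ u) := hu.continuous_fderiv one_ne_zero
  have int : ∀ {h : EuclideanSpace ℝ (Fin d) → ℝ} {L : Set (EuclideanSpace ℝ (Fin d))},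
      IsCompact L → Continuous h → IntegrableOn h L :=
    fun hL hh => hh.continuousOn.integrableOn_compact hL
  obtain _ | n := d
  · have hconst : ∀ x, u x = u 0 := fun x => congrArg u (Subsingleton.elim x 0)
    have hnn : 0 ≤ C * ((∫ _ in K, (1 : ℝ)) * ∫ x in K, ‖fderiv ℝ u x‖ ^ 2) := by positivity
    refine le_trans (le_of_eq ?_) hnn
    simp only [hconst, integral_const, smul_eq_mul]
    ring
  set k := ∫ _ in K, (1 : ℝ) with hk
  have hk0 : 0 ≤ k := integral_nonneg fun _ => zero_le_one
  rcases hk0.eq_or_lt with hkz | hkpos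
  · have hvol : volume K = 0 := by
      have : volume.real K = 0 := by simpa [hk] using hkz.symm
      rwa [measureReal_def, ENNReal.toReal_eq_zero_iff, or_iff_left hKc.measure_ne_top] at this
    simp [Measure.restrict_eq_zero.2 hvol]
  by_contra! hcon
  set m := (∫ x in K, u x) / k with hm
  set g : EuclideanSpace ℝ (Fin (n + 1)) → ℝ := fun x => u x - m with hg
  have cg : Continuous g := by fun_prop
  have hgint : ∫ x in K, g x = 0 := by
    have hmk : m * k = ∫ x in K, u x := div_mul_cancel₀ _ hkpos.ne'
    rw [integral_sub (int hKc cu) (int hKc continuous_const),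
      show ∫ _ in K, m = m * k by rw [hk, ← integral_const_mul, mul_one], hmk, sub_self]
  have hg2 : k * ∫ x in K, g x ^ 2 = k * (∫ x in K, u x ^ 2) - (∫ x in K, u x) ^ 2 := by
    have e : ∀ x, g x ^ 2 = u x ^ 2 - 2 * m * u x + m ^ 2 * 1 := fun x => by simp only [hg]; ring
    simp only [e]
    rw [integral_add (by exact (int hKc (by fun_prop))) (by exact (int hKc (by fun_prop))),
      integral_sub (by exact (int hKc (by fun_prop))) (by exact (int hKc (by fun_prop))),
      integral_const_mul, integral_const_mul, ← hk, hm]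
    field_simp
    ring
  set gap := (∫ x in K, g x ^ 2) - C * ∫ x in K, ‖fderiv ℝ u x‖ ^ 2 with hgap
  have hgap0 : 0 < gap := by
    refine pos_of_mul_pos_right (a := k) ?_ hk0
    rw [hgap, mul_sub, hg2]
    linarith
  set η := gap / (2 * k) with hη
  have hη0 : 0 < η := by positivity
  set f : EuclideanSpace ℝ (Fin (n + 1)) → ℝ := fun x => g x ^ 2 - C * ‖fderiv ℝ u x‖ ^ 2 - η with hf
  have cf : Continuous f := by fun_prop
  have hbody : IsNeedleBody g f K := by
    refine ⟨hKc, hK, hgint, ?_⟩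
    have e : ∫ x in K, f x = gap - η * k := by
      rw [hf, integral_sub (by exact (int hKc (by fun_prop))) (int hKc continuous_const),
        integral_sub (by exact (int hKc (by fun_prop))) (by exact (int hKc (by fun_prop))),
        integral_const_mul, show ∫ _ in K, η = η * k by rw [hk, ← integral_const_mul, mul_one]]
    have : η * k = gap / 2 := by rw [hη]; field_simp
    rw [e, this]
    linarith
  -- `ε` is such that `ε² + 2 M (1 + C) ε ≤ η`: replacing `u` by a ridge function within `ε` then
  -- costs less than the margin `η`
  obtain ⟨M₁, hM₁⟩ := hsupp.exists_bound_of_continuous cu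
  obtain ⟨M₂, hM₂⟩ := (hsupp.fderiv (𝕜 := ℝ)).exists_bound_of_continuous cDu
  set M := max (M₁ + |m|) M₂ with hMdef
  have hM0 : 0 ≤ M := le_max_of_le_right ((norm_nonneg _).trans (hM₂ 0))
  have hgM : ∀ x, |g x| ≤ M := fun x =>
    (abs_sub _ _).trans ((add_le_add_left (hM₁ x) _).trans (le_max_left _ _))
  have hDM : ∀ x, ‖fderiv ℝ u x‖ ≤ M := fun x => (hM₂ x).trans (le_max_right _ _)
  set ε := min 1 (η / (1 + 2 * M * (1 + C))) with hεdef
  have hden : 0 < 1 + 2 * M * (1 + C) := by positivity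
  have hε0 : 0 < ε := lt_min one_pos (by positivity)
  have hε1 : ε ≤ 1 := min_le_left _ _
  have hεη : ε * (1 + 2 * M * (1 + C)) ≤ η := (le_div_iff₀ hden).1 (min_le_right _ _)
  obtain ⟨δ₁, hδ₁, hu₁⟩ := Metric.uniformContinuous_iff.1
    (hsupp.uniformContinuous_of_continuous cu) ε hε0
  obtain ⟨δ₂, hδ₂, hu₂⟩ := Metric.uniformContinuous_iff.1
    ((hsupp.fderiv (𝕜 := ℝ)).uniformContinuous_of_continuous cDu) ε hε0
  obtain ⟨L, hLK, hL, y, e, he, hthin⟩ := hbody.exists_thin cg cf (lt_min hδ₁ hδ₂)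
  set w : ℝ → ℝ := fun t => g (y + t • e) with hw
  set w' : ℝ → ℝ := fun t => fderiv ℝ u (y + t • e) e with hw'
  have hwd : ∀ t, HasDerivAt w (w' t) t := by
    intro t
    have h1 : HasDerivAt (fun t : ℝ => y + t • e) e t := by
      simpa using ((hasDerivAt_id t).smul_const e).const_add y
    have h2 := ((hu.differentiable one_ne_zero (y + t • e)).hasFDerivAt.comp_hasDerivAt t h1)
    exact h2.sub_const m
  have cw' : Continuous w' := by fun_prop
  have cw : Continuous w := by fun_prop
  have hridge := variance_ridge_le hL.isCompact hL.convex
    ((Metric.diam_mono hLK hKc.isBounded).trans hR) he hwd cw'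
  set l := ∫ _ in L, (1 : ℝ) with hl
  set t : EuclideanSpace ℝ (Fin (n + 1)) → ℝ := fun x => inner ℝ e x with ht
  have ct : Continuous t := by fun_prop
  have hl0 : 0 ≤ l := integral_nonneg fun _ => zero_le_one
  have hconst : ∀ c : ℝ, ∫ _ in L, c = c * l := fun c => by
    rw [hl, ← integral_const_mul, mul_one]
  have hclose : ∀ x ∈ L, |g x - w (t x)| ≤ ε ∧ |fderiv ℝ u x e - w' (t x)| ≤ ε := by
    intro x hx
    have hx' := hthin x hx
    rw [← dist_eq_norm] at hx'
    constructor
    · have := (hu₁ (hx'.trans_le (min_le_left _ _))).le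
      rw [Real.dist_eq] at this
      simpa [hw, hg] using this
    · have := (hu₂ (hx'.trans_le (min_le_right _ _))).le
      rw [dist_eq_norm] at this
      calc |fderiv ℝ u x e - w' (t x)| = ‖(fderiv ℝ u x - fderiv ℝ u (y + t x • e)) e‖ := rfl
        _ ≤ ‖fderiv ℝ u x - fderiv ℝ u (y + t x • e)‖ * ‖e‖ := ContinuousLinearMap.le_opNorm _ _
        _ ≤ ε := by rw [he, mul_one]; exact this
  have hpt : ∀ x ∈ L, f x ≤ w (t x) ^ 2 - C * w' (t x) ^ 2 + (2 * M * (1 + C) * ε - η) := by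
    intro x hx
    obtain ⟨h1, h2⟩ := hclose x hx
    have sq : ∀ {p q : ℝ}, |p| ≤ M → |q| ≤ M → |p - q| ≤ ε → p ^ 2 ≤ q ^ 2 + 2 * M * ε := by
      intro p q hp hq hpq
      have : |p ^ 2 - q ^ 2| ≤ 2 * M * ε := by
        rw [sq_sub_sq, abs_mul]
        exact mul_le_mul ((abs_add_le p q).trans (by linarith)) hpq (abs_nonneg _) (by linarith)
      linarith [le_abs_self (p ^ 2 - q ^ 2)]
    have bD : ∀ z, |fderiv ℝ u z e| ≤ ‖fderiv ℝ u z‖ := fun z => by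
      have := (fderiv ℝ u z).le_opNorm e
      rwa [he, mul_one] at this
    have s1 := sq (hgM x) (hgM _) h1
    have s2 := sq ((bD _).trans (hDM _)) ((bD x).trans (hDM x)) (by rwa [abs_sub_comm] at h2)
    have s3 : fderiv ℝ u x e ^ 2 ≤ ‖fderiv ℝ u x‖ ^ 2 := sq_le_sq' (by
      linarith [neg_abs_le (fderiv ℝ u x e), bD x]) ((le_abs_self _).trans (bD x))
    have s4 : C * w' (t x) ^ 2 ≤ C * (‖fderiv ℝ u x‖ ^ 2 + 2 * M * ε) := by
      gcongr
      linarith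
    simp only [hf]
    linarith
  have hup : 0 < (∫ x in L, w (t x) ^ 2) - C * (∫ x in L, w' (t x) ^ 2) +
      (2 * M * (1 + C) * ε - η) * l := by
    refine hL.integral_pos.trans_le ?_
    rw [← hconst, ← integral_const_mul,
      ← integral_sub (by exact int hL.isCompact (by fun_prop))
        (by exact int hL.isCompact (by fun_prop)),
      ← integral_add (by exact int hL.isCompact (by fun_prop))
        (by exact int hL.isCompact (by fun_prop))]
    exact setIntegral_mono_on (int hL.isCompact cf) (int hL.isCompact (by fun_prop))
      hL.isCompact.measurableSet hpt
  have hmean : |∫ x in L, w (t x)| ≤ ε * l := by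
    have e1 : ∫ x in L, w (t x) = ∫ x in L, (w (t x) - g x) := by
      rw [integral_sub (int hL.isCompact (by fun_prop)) (int hL.isCompact cg), hL.integral_eq_zero,
        sub_zero]
    rw [e1, ← hconst]
    refine (abs_integral_le_integral_abs).trans (setIntegral_mono_on
      (int hL.isCompact (by fun_prop)) (int hL.isCompact continuous_const)
      hL.isCompact.measurableSet fun x hx => ?_)
    rw [abs_sub_comm]
    exact (hclose x hx).1
  have hlpos : 0 < l := by
    refine hl0.lt_of_ne fun hlz => ?_
    have hvol : volume L = 0 := by
      have : volume.real L = 0 := by simpa [hl] using hlz.symm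
      rwa [measureReal_def, ENNReal.toReal_eq_zero_iff, or_iff_left hL.isCompact.measure_ne_top]
        at this
    have := hL.integral_pos
    simp [Measure.restrict_eq_zero.2 hvol] at this
  have hmean2 : (∫ x in L, w (t x)) ^ 2 ≤ (ε * l) ^ 2 := sq_le_sq' (by
    linarith [neg_abs_le (∫ x in L, w (t x))]) ((le_abs_self _).trans hmean)
  have hfin : (∫ x in L, w (t x) ^ 2) - C * (∫ x in L, w' (t x) ^ 2) ≤ ε ^ 2 * l := by
    refine le_of_mul_le_mul_left ?_ hlpos
    linarith
  have : 0 < (ε ^ 2 + 2 * M * (1 + C) * ε - η) * l := by linarith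
  have h1 : 0 < ε ^ 2 + 2 * M * (1 + C) * ε - η := pos_of_mul_pos_left this hl0
  nlinarith

/-! ### Payne–Weinberger inequality for Sobolev functions -/

section Sobolev

variable {d : ℕ} {D : Set (EuclideanSpace ℝ (Fin d))} {v : EuclideanSpace ℝ (Fin d) → ℝ}
  {g : EuclideanSpace ℝ (Fin d) → EuclideanSpace ℝ (Fin d)}

/-- The points of `D` at distance at least `ε` from the complement of `D`. The strict inequality
`‖h‖ < ε` makes this set closed. -/
def innerParallelSet (D : Set (EuclideanSpace ℝ (Fin d))) (ε : ℝ) :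
    Set (EuclideanSpace ℝ (Fin d)) :=
  {x | ∀ h, ‖h‖ < ε → x + h ∈ D}

theorem innerParallelSet_subset {ε : ℝ} (hε : 0 < ε) : innerParallelSet D ε ⊆ D := fun x hx => by
  simpa using hx 0 (by simpa using hε)

theorem convex_innerParallelSet (hD : Convex ℝ D) (ε : ℝ) : Convex ℝ (innerParallelSet D ε) := by
  intro x hx y hy a b ha hb hab h hh
  have := hD (hx h hh) (hy h hh) ha hb hab
  convert this using 1
  rw [smul_add, smul_add, add_add_add_comm, ← add_smul, hab, one_smul]

theorem isClosed_innerParallelSet (ε : ℝ) : IsClosed (innerParallelSet D ε) := by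
  refine isClosed_iff_clusterPt.2 fun x hx h hh => ?_
  have hU : {z | ‖x + h - z‖ < ε} ∈ 𝓝 x :=
    (isOpen_lt (by fun_prop) continuous_const).mem_nhds (by simpa using hh)
  obtain ⟨z, hz1, hz2⟩ := clusterPt_principal_iff.1 hx _ hU
  simpa using hz2 (x + h - z) hz1

theorem isCompact_innerParallelSet (hD : Bornology.IsBounded D) {ε : ℝ} (hε : 0 < ε) :
    IsCompact (innerParallelSet D ε) :=
  Metric.isCompact_of_isClosed_isBounded (isClosed_innerParallelSet ε)
    (hD.subset (innerParallelSet_subset hε))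

theorem eventually_mem_innerParallelSet (hD : IsOpen D) {x : EuclideanSpace ℝ (Fin d)} (hx : x ∈ D) :
    ∀ᶠ ε in 𝓝 (0 : ℝ), x ∈ innerParallelSet D ε := by
  obtain ⟨δ, hδ, hball⟩ := Metric.isOpen_iff.1 hD x hx
  filter_upwards [gt_mem_nhds hδ] with ε hε h hh
  exact hball (by simpa using hh.trans hε)

/-- Jensen's inequality for the square and a sub-probability density. -/
theorem sq_integral_mul_le {α : Type*} [MeasurableSpace α] {μ : Measure α} {φ s : α → ℝ}
    (hφ : ∀ x, 0 ≤ φ x) (h1 : ∫ x, φ x ∂μ ≤ 1) (i0 : Integrable φ μ)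
    (i1 : Integrable (fun x => φ x * s x) μ) (i2 : Integrable (fun x => φ x * s x ^ 2) μ) :
    (∫ x, φ x * s x ∂μ) ^ 2 ≤ ∫ x, φ x * s x ^ 2 ∂μ := by
  set c := ∫ x, φ x * s x ∂μ with hc
  have hnn : 0 ≤ ∫ x, φ x * (s x - c) ^ 2 ∂μ :=
    integral_nonneg fun x => mul_nonneg (hφ x) (sq_nonneg _)
  have e : ∀ x, φ x * (s x - c) ^ 2 = φ x * s x ^ 2 - 2 * c * (φ x * s x) + c ^ 2 * φ x :=
    fun x => by ring
  simp only [e] at hnn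
  rw [integral_add (by exact i2.sub (i1.const_mul _)) (i0.const_mul _), integral_sub i2 (i1.const_mul _),
    integral_const_mul, integral_const_mul, ← hc] at hnn
  nlinarith [sq_nonneg c, mul_nonneg (sq_nonneg c) (sub_nonneg.2 h1)]

/-- Away from the boundary of `D`, the derivative of a mollification of `v` is the mollification of
the weak gradient of `v`. -/
theorem fderiv_mollify_apply (hDo : IsOpen D) (hv : IntegrableOn v D) (hg : IntegrableOn g D)
    (hvg : DataPoincare.IsWeakGradient D v g) (φ : ContDiffBump (0 : EuclideanSpace ℝ (Fin d)))
    {ε : ℝ} (hφε : φ.rOut < ε) {x : EuclideanSpace ℝ (Fin d)} (hx : x ∈ innerParallelSet D ε)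
    (h : EuclideanSpace ℝ (Fin d)) :
    fderiv ℝ (φ.normed volume ⋆[ContinuousLinearMap.lsmul ℝ ℝ, volume] D.indicator v) x h =
      inner ℝ (∫ y in D, φ.normed volume (x - y) • g y) h := by
  have hvi : LocallyIntegrable (D.indicator v) volume :=
    ((integrable_indicator_iff hDo.measurableSet).2 hv).locallyIntegrable
  set ρ := φ.normed volume with hρ
  have hρc : HasCompactSupport ρ := φ.hasCompactSupport_normed
  have hρs : ContDiff ℝ ∞ ρ := φ.contDiff_normed
  have hρd : Continuous (fderiv ℝ ρ) := hρs.continuous_fderiv (by simp)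
  have hder : fderiv ℝ (ρ ⋆[ContinuousLinearMap.lsmul ℝ ℝ, volume] D.indicator v) x = _ :=
    (hρc.hasFDerivAt_convolution_left (ContinuousLinearMap.lsmul ℝ ℝ)
      (hρs.of_le (by simp)) hvi x).fderiv
  have hex := ((hρc.fderiv (𝕜 := ℝ)).convolutionExists_left (μ := volume)
    (ContinuousLinearMap.precompL (EuclideanSpace ℝ (Fin d)) (ContinuousLinearMap.lsmul ℝ ℝ))
    hρd hvi x).integrable_swap
  have happ : ∀ h, fderiv ℝ (ρ ⋆[ContinuousLinearMap.lsmul ℝ ℝ, volume] D.indicator v) x h =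
      ∫ y in D, v y * fderiv ℝ ρ (x - y) h := by
    intro h
    rw [hder, convolution_eq_swap, ContinuousLinearMap.integral_apply hex,
      ← integral_indicator hDo.measurableSet]
    refine integral_congr_ae (Eventually.of_forall fun y => ?_)
    by_cases hy : y ∈ D <;> simp [hy, mul_comm]
  -- the weak gradient is tested with `y ↦ ρ (x - y)`, which is supported in `D`
  have hψ : ContDiff ℝ ∞ fun y => ρ (x - y) := hρs.comp (by fun_prop)
  have hsub : tsupport (fun y => ρ (x - y)) ⊆ Metric.closedBall x φ.rOut := by
    refine closure_minimal (fun y hy => ?_) Metric.isClosed_closedBall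
    have : x - y ∈ Function.support ρ := hy
    rw [hρ, φ.support_normed_eq] at this
    rw [Metric.mem_closedBall, dist_comm, dist_eq_norm]
    simpa using (mem_ball_zero_iff.1 this).le
  have hψd : ∀ y h, fderiv ℝ (fun y => ρ (x - y)) y h = -fderiv ℝ ρ (x - y) h := by
    intro y h
    have h1 : HasFDerivAt (fun y => x - y) (-ContinuousLinearMap.id ℝ _) y :=
      (hasFDerivAt_id y).const_sub x
    have h2 := ((hρs.differentiable (by simp)) (x - y)).hasFDerivAt.comp y h1
    have h3 : fderiv ℝ (fun y => ρ (x - y)) y = _ := h2.fderiv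
    rw [h3]
    simp
  obtain ⟨C, hC⟩ := hρc.exists_bound_of_continuous hρs.continuous
  have hgi : Integrable (fun y => ρ (x - y) • g y) (volume.restrict D) :=
    Integrable.bdd_smul (𝕜 := ℝ) hg C (Continuous.aestronglyMeasurable
      (hρs.continuous.comp (by fun_prop))) (Eventually.of_forall fun y => hC _)
  have hbasis : ∀ j : Fin d,
      fderiv ℝ (ρ ⋆[ContinuousLinearMap.lsmul ℝ ℝ, volume] D.indicator v) x
        (EuclideanSpace.single j 1) = (∫ y in D, ρ (x - y) • g y) j := by
    intro j
    have := hvg _ hψ ((isCompact_closedBall x φ.rOut).of_isClosed_subset (isClosed_tsupport _) hsub)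
      (hsub.trans fun y hy => by
        have := hx (y - x) (by rw [← dist_eq_norm]; exact (Metric.mem_closedBall.1 hy).trans_lt hφε)
        simpa using this) j
    simp only [hψd, mul_neg, integral_neg, neg_inj] at this
    rw [happ, this]
    have hproj := (EuclideanSpace.proj j : EuclideanSpace ℝ (Fin d) →L[ℝ] ℝ).integral_comp_comm hgi
    change ∫ y in D, ρ (x - y) * g y j = (∫ y in D, ρ (x - y) • g y) j at hproj
    rw [← hproj]
    simp only [mul_comm]
  have hlin : (fderiv ℝ (ρ ⋆[ContinuousLinearMap.lsmul ℝ ℝ, volume] D.indicator v) x).toLinearMap =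
      (innerSL ℝ (∫ y in D, ρ (x - y) • g y)).toLinearMap := by
    refine (EuclideanSpace.basisFun (Fin d) ℝ).toBasis.ext fun j => ?_
    simp only [OrthonormalBasis.coe_toBasis, EuclideanSpace.basisFun_apply,
      ContinuousLinearMap.coe_coe, innerSL_apply_apply]
    rw [hbasis j, EuclideanSpace.inner_single_right]
    simp
  exact congrArg (fun L : EuclideanSpace ℝ (Fin d) →ₗ[ℝ] ℝ => L h) hlin

/-- The Dirichlet energy does not increase under mollification, away from the boundary. -/
theorem setIntegral_norm_fderiv_mollify_sq_le (hDo : IsOpen D) (hDb : Bornology.IsBounded D)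
    (hv : IntegrableOn v D) (hg : MemLp g 2 (volume.restrict D))
    (hvg : DataPoincare.IsWeakGradient D v g) (φ : ContDiffBump (0 : EuclideanSpace ℝ (Fin d)))
    {ε : ℝ} (hφε : φ.rOut < ε) :
    ∫ x in innerParallelSet D ε, ‖fderiv ℝ
      (φ.normed volume ⋆[ContinuousLinearMap.lsmul ℝ ℝ, volume] D.indicator v) x‖ ^ 2 ≤
      ∫ x in D, ‖g x‖ ^ 2 := by
  have : IsFiniteMeasure (volume.restrict D) := ⟨by simpa using hDb.measure_lt_top⟩
  have hg1 : IntegrableOn g D := hg.integrable (by norm_num)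
  have hg2 : IntegrableOn (fun x => ‖g x‖ ^ 2) D := hg.integrable_norm_pow (by norm_num)
  set ρ := φ.normed volume with hρ
  have hρc : HasCompactSupport ρ := φ.hasCompactSupport_normed
  have hρ0 : ∀ x, 0 ≤ ρ x := φ.nonneg_normed
  have hρcont : Continuous ρ := φ.continuous_normed
  have hρi : Integrable ρ := φ.integrable_normed
  obtain ⟨C, hC⟩ := hρc.exists_bound_of_continuous hρcont
  set G := D.indicator fun x => ‖g x‖ ^ 2 with hG
  have hGi : Integrable G := (integrable_indicator_iff hDo.measurableSet).2 hg2
  have hG0 : ∀ x, 0 ≤ G x := indicator_nonneg fun x _ => sq_nonneg _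
  have hcongG : ∀ x, (ρ ⋆[ContinuousLinearMap.lsmul ℝ ℝ, volume] G) x =
      ∫ y in D, ρ (x - y) * ‖g y‖ ^ 2 := by
    intro x
    rw [convolution_eq_swap, ← integral_indicator hDo.measurableSet]
    refine integral_congr_ae (Eventually.of_forall fun y => ?_)
    by_cases hy : y ∈ D <;> simp [hG, hy]
  have hpt : ∀ x ∈ innerParallelSet D ε, ‖fderiv ℝ
      (ρ ⋆[ContinuousLinearMap.lsmul ℝ ℝ, volume] D.indicator v) x‖ ^ 2 ≤
      (ρ ⋆[ContinuousLinearMap.lsmul ℝ ℝ, volume] G) x := by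
    intro x hx
    have cx : Continuous fun y => ρ (x - y) := hρcont.comp (by fun_prop)
    have bnd : ∀ᵐ y ∂(volume.restrict D), ‖ρ (x - y)‖ ≤ C := Eventually.of_forall fun y => hC _
    have h1 : ‖fderiv ℝ (ρ ⋆[ContinuousLinearMap.lsmul ℝ ℝ, volume] D.indicator v) x‖ ≤
        ∫ y in D, ρ (x - y) * ‖g y‖ := by
      calc _ ≤ ‖∫ y in D, ρ (x - y) • g y‖ := by
            refine ContinuousLinearMap.opNorm_le_bound _ (norm_nonneg _) fun h => ?_
            rw [fderiv_mollify_apply hDo hv hg1 hvg φ hφε hx h]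
            exact norm_inner_le_norm _ _
        _ ≤ ∫ y in D, ‖ρ (x - y) • g y‖ := norm_integral_le_integral_norm _
        _ = _ := by simp only [norm_smul, Real.norm_of_nonneg (hρ0 _)]
    have hρx : Integrable fun y => ρ (x - y) := hρi.comp_sub_left x
    have h2 : ∫ y in D, ρ (x - y) ≤ 1 := by
      calc ∫ y in D, ρ (x - y) ≤ ∫ y, ρ (x - y) :=
            setIntegral_le_integral hρx (Eventually.of_forall fun y => hρ0 _)
        _ = 1 := by rw [integral_sub_left_eq_self ρ, hρ, φ.integral_normed]
    rw [hcongG]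
    refine (pow_le_pow_left₀ (norm_nonneg _) h1 2).trans
      (sq_integral_mul_le (fun y => hρ0 _) h2 hρx.integrableOn ?_ ?_)
    · exact Integrable.bdd_mul hg1.norm cx.aestronglyMeasurable bnd
    · exact Integrable.bdd_mul hg2 cx.aestronglyMeasurable bnd
  have hconvi := hρi.integrable_convolution (ContinuousLinearMap.lsmul ℝ ℝ) hGi
  have hconv0 : ∀ x, 0 ≤ (ρ ⋆[ContinuousLinearMap.lsmul ℝ ℝ, volume] G) x := fun x => by
    rw [hcongG]
    exact integral_nonneg fun y => mul_nonneg (hρ0 _) (sq_nonneg _)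
  calc _ ≤ ∫ x in innerParallelSet D ε, (ρ ⋆[ContinuousLinearMap.lsmul ℝ ℝ, volume] G) x := by
        refine integral_mono_of_nonneg (Eventually.of_forall fun x => sq_nonneg _)
          hconvi.integrableOn ?_
        filter_upwards [ae_restrict_mem (isClosed_innerParallelSet ε).measurableSet] with x hx
        exact hpt x hx
    _ ≤ ∫ x, (ρ ⋆[ContinuousLinearMap.lsmul ℝ ℝ, volume] G) x :=
        setIntegral_le_integral hconvi (Eventually.of_forall hconv0)
    _ = ∫ x in D, ‖g x‖ ^ 2 := by
        rw [integral_convolution (ContinuousLinearMap.lsmul ℝ ℝ) hρi hGi, hρ, φ.integral_normed, hG,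
          integral_indicator hDo.measurableSet]
        simp

/-- The variance as a double integral; this form does not mention the mean value. -/
theorem lintegral_prod_sub_sq {α : Type*} [MeasurableSpace α] {μ : Measure α} [IsFiniteMeasure μ]
    {u : α → ℝ} (hu : MemLp u 2 μ) :
    ∫⁻ z, ENNReal.ofReal ((u z.1 - u z.2) ^ 2) ∂(μ.prod μ) =
      ENNReal.ofReal (2 * ((∫ _, (1 : ℝ) ∂μ) * (∫ x, u x ^ 2 ∂μ) - (∫ x, u x ∂μ) ^ 2)) := by
  have i1 : Integrable u μ := hu.integrable (by norm_num)
  have i2 : Integrable (fun x => u x ^ 2) μ := hu.integrable_sq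
  have i0 : Integrable (fun _ => (1 : ℝ)) μ := integrable_const 1
  have e : ∀ z : α × α, (u z.1 - u z.2) ^ 2 =
      u z.1 ^ 2 * 1 - 2 * (u z.1 * u z.2) + 1 * u z.2 ^ 2 := fun z => by ring
  have j1 := i2.mul_prod i0
  have j2 := (i1.mul_prod i1).const_mul 2
  have j3 := i0.mul_prod i2
  rw [← ofReal_integral_eq_lintegral_ofReal]
  · congr 1
    simp only [e]
    rw [integral_add (by exact j1.sub j2) j3, integral_sub j1 j2, integral_const_mul,
      integral_prod_mul u u, integral_prod_mul (fun x => u x ^ 2) (fun _ => (1 : ℝ)),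
      integral_prod_mul (fun _ => (1 : ℝ)) (fun x => u x ^ 2)]
    ring
  · simp only [e]
    exact (j1.sub j2).add j3
  · exact Eventually.of_forall fun z => sq_nonneg _

/-- The Payne–Weinberger inequality in variance form, for `H¹` functions on a bounded convex open set.
Mollifications are compared on inner parallel sets, and Fatou's lemma is applied to the double
integral. -/
theorem variance_le_of_isWeakGradient (hDo : IsOpen D) (hDc : Convex ℝ D)
    (hDb : Bornology.IsBounded D) {R : ℝ} (hR : Metric.diam D ≤ R)
    (hv : MemLp v 2 (volume.restrict D)) (hg : MemLp g 2 (volume.restrict D))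
    (hvg : DataPoincare.IsWeakGradient D v g) :
    (∫ _ in D, (1 : ℝ)) * (∫ x in D, v x ^ 2) - (∫ x in D, v x) ^ 2 ≤
      R ^ 2 / Real.pi ^ 2 * ((∫ _ in D, (1 : ℝ)) * ∫ x in D, ‖g x‖ ^ 2) := by
  have hfin : IsFiniteMeasure (volume.restrict D) := ⟨by simpa using hDb.measure_lt_top⟩
  have hv1 : IntegrableOn v D := hv.integrable (by norm_num)
  have hvi : LocallyIntegrable (D.indicator v) volume :=
    ((integrable_indicator_iff hDo.measurableSet).2 hv1).locallyIntegrable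
  have hr : ∀ n : ℕ, (0 : ℝ) < 1 / ((n : ℝ) + 1) := fun n => Nat.one_div_pos_of_nat
  -- the radius `1 / (n + 1)` of the mollifier is half the width of the layer removed from `D`
  let φ : ℕ → ContDiffBump (0 : EuclideanSpace ℝ (Fin d)) := fun n =>
    ⟨1 / ((n : ℝ) + 1) / 2, 1 / ((n : ℝ) + 1), half_pos (hr n), half_lt_self (hr n)⟩
  set K : ℕ → Set (EuclideanSpace ℝ (Fin d)) := fun n => innerParallelSet D (2 * (1 / ((n : ℝ) + 1)))
    with hK
  set u : ℕ → EuclideanSpace ℝ (Fin d) → ℝ := fun n =>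
    (φ n).normed volume ⋆[ContinuousLinearMap.lsmul ℝ ℝ, volume] D.indicator v with hu
  have hr2 : ∀ n : ℕ, (0 : ℝ) < 2 * (1 / ((n : ℝ) + 1)) := fun n => by have := hr n; positivity
  have hKD : ∀ n, K n ⊆ D := fun n => innerParallelSet_subset (hr2 n)
  have hKc : ∀ n, IsCompact (K n) := fun n => isCompact_innerParallelSet hDb (hr2 n)
  have hKm : ∀ n, MeasurableSet (K n) := fun n => (hKc n).measurableSet
  have hu1 : ∀ n, ContDiff ℝ 1 (u n) := fun n =>
    (φ n).hasCompactSupport_normed.contDiff_convolution_left (n := 1) _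
      (φ n).contDiff_normed hvi
  have husupp : ∀ n, HasCompactSupport (u n) := fun n =>
    HasCompactSupport.convolution _ (φ n).hasCompactSupport_normed
      (HasCompactSupport.intro hDb.isCompact_closure fun x hx =>
        indicator_of_notMem (fun h => hx (subset_closure h)) v)
  set B : ℝ := 2 * (R ^ 2 / Real.pi ^ 2 * ((∫ _ in D, (1 : ℝ)) * ∫ x in D, ‖g x‖ ^ 2)) with hB
  set μD := (volume.restrict D).prod (volume.restrict D) with hμD
  set H : ℕ → EuclideanSpace ℝ (Fin d) × EuclideanSpace ℝ (Fin d) → ℝ≥0∞ := fun n =>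
    (K n ×ˢ K n).indicator fun z => ENNReal.ofReal ((u n z.1 - u n z.2) ^ 2) with hH
  have hHm : ∀ n, Measurable (H n) := fun n => by
    have := (hu1 n).continuous
    exact Measurable.indicator (ENNReal.measurable_ofReal.comp (Continuous.measurable (by fun_prop)))
      ((hKm n).prod (hKm n))
  have hbound : ∀ n, ∫⁻ z, H n z ∂μD ≤ ENNReal.ofReal B := by
    intro n
    have : IsFiniteMeasure (volume.restrict (K n)) :=
      ⟨by simpa using (hKc n).measure_lt_top⟩
    rw [hH, lintegral_indicator ((hKm n).prod (hKm n)), hμD, Measure.prod_restrict,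
      Measure.restrict_restrict ((hKm n).prod (hKm n)), prod_inter_prod,
      inter_eq_left.2 (hKD n), ← Measure.prod_restrict,
      lintegral_prod_sub_sq (((hu1 n).continuous.memLp_of_hasCompactSupport (husupp n)).restrict _)]
    refine ENNReal.ofReal_le_ofReal (mul_le_mul_of_nonneg_left ?_ zero_le_two)
    refine (variance_le_of_contDiff (hKc n) (convex_innerParallelSet hDc _)
      ((Metric.diam_mono (hKD n) hDb).trans hR) (hu1 n) (husupp n)).trans ?_
    have h1 : ∫ _ in K n, (1 : ℝ) ≤ ∫ _ in D, (1 : ℝ) :=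
      setIntegral_mono_set (integrable_const _) (Eventually.of_forall fun _ => zero_le_one)
        (hKD n).eventuallyLE
    have h2 := setIntegral_norm_fderiv_mollify_sq_le hDo hDb hv1 hg hvg (φ n)
      (ε := 2 * (1 / ((n : ℝ) + 1))) (by
        show 1 / ((n : ℝ) + 1) < _
        linarith [hr n])
    have h3 : (0 : ℝ) ≤ ∫ _ in D, (1 : ℝ) := integral_nonneg fun _ => zero_le_one
    gcongr
  have hlim1 : Tendsto (fun n : ℕ => 1 / ((n : ℝ) + 1)) atTop (𝓝 0) :=
    tendsto_one_div_add_atTop_nhds_zero_nat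
  have hae : ∀ᵐ x, Tendsto (fun n => u n x) atTop (𝓝 (D.indicator v x)) :=
    ContDiffBump.ae_convolution_tendsto_right_of_locallyIntegrable (φ := φ) (K := 2) hlim1
      (Eventually.of_forall fun n => by
        show 1 / ((n : ℝ) + 1) ≤ 2 * (1 / ((n : ℝ) + 1) / 2)
        linarith) hvi
  have hae' : ∀ᵐ x ∂(volume.restrict D), x ∈ D ∧ Tendsto (fun n => u n x) atTop (𝓝 (v x)) := by
    filter_upwards [ae_restrict_mem hDo.measurableSet, ae_restrict_of_ae hae] with x hx h
    rw [indicator_of_mem hx] at h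
    exact ⟨hx, h⟩
  have hmem : ∀ x ∈ D, ∀ᶠ n in atTop, x ∈ K n := fun x hx => by
    have : Tendsto (fun n : ℕ => 2 * (1 / ((n : ℝ) + 1))) atTop (𝓝 0) := by
      simpa using hlim1.const_mul 2
    exact this.eventually (eventually_mem_innerParallelSet hDo hx)
  have hfatou : ∫⁻ z, ENNReal.ofReal ((v z.1 - v z.2) ^ 2) ∂μD ≤ ENNReal.ofReal B := by
    calc ∫⁻ z, ENNReal.ofReal ((v z.1 - v z.2) ^ 2) ∂μD
        = ∫⁻ z, liminf (fun n => H n z) atTop ∂μD := by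
          refine lintegral_congr_ae ?_
          filter_upwards [Measure.quasiMeasurePreserving_fst.ae hae',
            Measure.quasiMeasurePreserving_snd.ae hae'] with z h1 h2
          have ht : Tendsto (fun n => ENNReal.ofReal ((u n z.1 - u n z.2) ^ 2)) atTop
              (𝓝 (ENNReal.ofReal ((v z.1 - v z.2) ^ 2))) :=
            ENNReal.tendsto_ofReal ((h1.2.sub h2.2).pow 2)
          refine (Tendsto.liminf_eq (ht.congr' ?_)).symm
          filter_upwards [hmem _ h1.1, hmem _ h2.1] with n k1 k2
          have hz : z ∈ K n ×ˢ K n := ⟨k1, k2⟩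
          simp only [hH, indicator_of_mem hz]
      _ ≤ liminf (fun n => ∫⁻ z, H n z ∂μD) atTop := lintegral_liminf_le hHm
      _ ≤ liminf (fun _ : ℕ => ENNReal.ofReal B) atTop :=
          liminf_le_liminf (Eventually.of_forall hbound)
      _ = ENNReal.ofReal B := liminf_const _
  rw [hμD, lintegral_prod_sub_sq hv, ENNReal.ofReal_le_ofReal_iff (by positivity)] at hfatou
  linarith

end Sobolev

/-! ### Poincaré inequality with local averages as data -/

namespace DataPoincare

variable {d m : ℕ} {Ω D B : Set (E d)} {v : E d → ℝ} {g : E d → E d}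

theorem IsWeakGradient.mono (h : IsWeakGradient Ω v g) (hΩ : MeasurableSet Ω) (hD : D ⊆ Ω) :
    IsWeakGradient D v g := by
  intro φ h1 h2 h3 j
  have := h φ h1 h2 (h3.trans hD) j
  rwa [setIntegral_eq_of_subset_of_forall_sdiff_eq_zero hΩ hD fun x hx => ?_,
    setIntegral_eq_of_subset_of_forall_sdiff_eq_zero hΩ hD fun x hx => ?_] at this
  · rw [image_eq_zero_of_notMem_tsupport fun hn => hx.2 (h3 hn), mul_zero]
  · rw [fderiv_of_notMem_tsupport ℝ fun hn => hx.2 (h3 hn)]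
    simp

theorem l2Norm_sq {F : Type*} [NormedAddCommGroup F] {f : E d → F}
    (hf : AEStronglyMeasurable f (volume.restrict Ω)) : l2Norm Ω f ^ 2 = ∫ x in Ω, ‖f x‖ ^ 2 := by
  have h0 : 0 ≤ ∫ x in Ω, ‖f x‖ ^ 2 := integral_nonneg fun x => sq_nonneg _
  rw [l2Norm, lpNorm_eq_integral_norm_rpow_toReal two_ne_zero ENNReal.ofNat_ne_top hf]
  simp only [ENNReal.toReal_ofNat, Real.rpow_ofNat]
  rw [← Real.rpow_natCast, ← Real.rpow_mul h0]
  norm_num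

/-- Poincaré's inequality with the data `⨍_B v` from a subset `B` of the convex set `D`: passing from
the mean over `D` to the mean over `B` costs a multiple of `|D| / |B|`. -/
theorem setIntegral_sq_le_of_subset (hBD : B ⊆ D)
    (hB : 0 < volume.real B) (hDfin : volume D ≠ ⊤) (hv : MemLp v 2 (volume.restrict D)) {P : ℝ}
    (hP : volume.real D * (∫ x in D, v x ^ 2) - (∫ x in D, v x) ^ 2 ≤ volume.real D * P) :
    ∫ x in D, v x ^ 2 ≤ 3 * (volume.real D / volume.real B) *
      (P + volume.real B * (⨍ x in B, v x) * (⨍ x in B, v x)) := by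
  have : IsFiniteMeasure (volume.restrict D) := ⟨by simpa using hDfin.lt_top⟩
  have : IsFiniteMeasure (volume.restrict B) :=
    ⟨by simpa using (measure_mono hBD).trans_lt hDfin.lt_top⟩
  have hvB : MemLp v 2 (volume.restrict B) := hv.mono_measure (Measure.restrict_mono hBD le_rfl)
  have expand : ∀ {S : Set (E d)} [IsFiniteMeasure (volume.restrict S)],
      MemLp v 2 (volume.restrict S) → ∀ c : ℝ, ∫ x in S, (v x - c) ^ 2 =
        (∫ x in S, v x ^ 2) - 2 * c * (∫ x in S, v x) + c ^ 2 * volume.real S := by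
    intro S _ hvS c
    have i1 : Integrable v (volume.restrict S) := hvS.integrable (by norm_num)
    have e : ∀ x, (v x - c) ^ 2 = v x ^ 2 - 2 * c * v x + c ^ 2 := fun x => by ring
    simp only [e]
    rw [integral_add (by exact hvS.integrable_sq.sub (i1.const_mul _)) (integrable_const _),
      integral_sub hvS.integrable_sq (i1.const_mul _), integral_const_mul, integral_const]
    simp only [measureReal_restrict_apply_univ, smul_eq_mul]
    ring
  rw [setAverage_eq, smul_eq_mul]
  set k := volume.real D with hk
  set β := volume.real B with hβ
  set X := ∫ x in D, v x ^ 2 with hX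
  set s := ∫ x in D, v x with hs
  set t := ∫ x in B, v x with ht
  have hβk : β ≤ k := measureReal_mono hBD hDfin
  have hk0 : 0 < k := hB.trans_le hβk
  set a := s / k with ha
  set b := β⁻¹ * t with hb
  have hs' : s = a * k := (div_mul_cancel₀ _ hk0.ne').symm
  have ht' : t = β * b := by rw [hb, ← mul_assoc, mul_inv_cancel₀ hB.ne', one_mul]
  have hXa : X - k * a ^ 2 ≤ P := by
    refine le_of_mul_le_mul_left (le_trans (le_of_eq ?_) hP) hk0
    rw [hs']; ring
  have hBa : β * (b - a) ^ 2 ≤ X - k * a ^ 2 := by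
    have h1 : ∫ x in B, (v x - a) ^ 2 ≤ ∫ x in D, (v x - a) ^ 2 := by
      refine setIntegral_mono_set ?_ (Eventually.of_forall fun x => sq_nonneg _) hBD.eventuallyLE
      exact (hv.sub (memLp_const a)).integrable_sq
    have h2 : 0 ≤ ∫ x in B, (v x - b) ^ 2 := integral_nonneg fun x => sq_nonneg _
    rw [expand hvB, expand hv, ← ht, ← hβ, ← hX, ← hs, ← hk] at h1
    rw [expand hvB, ← ht, ← hβ] at h2
    rw [ht'] at h1 h2
    rw [hs'] at h1
    nlinarith
  set r := k / β with hr
  have hr1 : 1 ≤ r := (one_le_div hB).2 hβk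
  have hkr : k = r * β := (div_mul_cancel₀ _ hB.ne').symm
  have ha2 : k * a ^ 2 ≤ 2 * r * P + 2 * r * (β * b ^ 2) := by
    have h1 : a ^ 2 ≤ 2 * (b - a) ^ 2 + 2 * b ^ 2 := by nlinarith [sq_nonneg (2 * b - a)]
    have h2 : r * (β * (b - a) ^ 2) ≤ r * P := by gcongr; linarith
    have h3 : r * β * a ^ 2 ≤ r * β * (2 * (b - a) ^ 2 + 2 * b ^ 2) := by gcongr
    rw [hkr]
    linarith
  have hP0 : 0 ≤ P := le_trans (by positivity) (hBa.trans hXa)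
  have h4 : P ≤ r * P := le_mul_of_one_le_left hP0 hr1
  have h5 : 0 ≤ r * (β * b ^ 2) := by positivity
  calc X ≤ P + k * a ^ 2 := by linarith
    _ ≤ r * P + (2 * r * P + 2 * r * (β * b ^ 2)) + r * (β * b ^ 2) := by linarith
    _ = 3 * r * (P + β * b * b) := by ring

theorem setIntegral_sq_le_of_eq (hB : 0 < volume.real B) {P : ℝ}
    (hP : volume.real B * (∫ x in B, v x ^ 2) - (∫ x in B, v x) ^ 2 ≤ volume.real B * P) :
    ∫ x in B, v x ^ 2 ≤ P + volume.real B * (⨍ x in B, v x) * (⨍ x in B, v x) := by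
  rw [setAverage_eq, smul_eq_mul]
  refine le_of_mul_le_mul_left ?_ hB
  have : volume.real B * (volume.real B * ((volume.real B)⁻¹ * ∫ x in B, v x) *
      ((volume.real B)⁻¹ * ∫ x in B, v x)) = (∫ x in B, v x) ^ 2 := by
    field_simp
  rw [mul_add, this]
  linarith

section Cover

variable {K : Fin m → Set (E d)} {f : E d → ℝ}

theorem setIntegral_le_sum_interior (hΩ : IsOpen Ω) (hK : ∀ i, Convex ℝ (K i))
    (hKΩ : ∀ i, interior (K i) ⊆ Ω) (hcover : Ω ⊆ ⋃ i, closure (K i)) (hf : IntegrableOn f Ω)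
    (hf0 : ∀ x, 0 ≤ f x) : ∫ x in Ω, f x ≤ ∑ i, ∫ x in interior (K i), f x := by
  have hi : ∀ i, IntegrableOn ((interior (K i)).indicator f) Ω := fun i =>
    hf.indicator isOpen_interior.measurableSet
  have e : ∀ i, ∫ x in interior (K i), f x = ∫ x in Ω, (interior (K i)).indicator f x := fun i => by
    rw [setIntegral_indicator isOpen_interior.measurableSet, inter_eq_right.2 (hKΩ i)]
  simp only [e]
  rw [← integral_finsetSum _ fun i _ => hi i]
  refine integral_mono_ae hf (integrable_finsetSum _ fun i _ => hi i) ?_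
  have hfr : ∀ᵐ x ∂(volume.restrict Ω), ∀ i, x ∉ frontier (K i) :=
    ae_all_iff.2 fun i => ae_restrict_of_ae
      (measure_eq_zero_iff_ae_notMem.1 ((hK i).addHaar_frontier volume))
  filter_upwards [hfr, ae_restrict_mem hΩ.measurableSet] with x hx hxΩ
  obtain ⟨i, hi⟩ := mem_iUnion.1 (hcover hxΩ)
  have hxi : x ∈ interior (K i) := by
    by_contra hn
    exact hx i ⟨hi, hn⟩
  calc f x = (interior (K i)).indicator f x := (indicator_of_mem hxi f).symm
    _ ≤ ∑ i, (interior (K i)).indicator f x :=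
        Finset.single_le_sum (f := fun i => (interior (K i)).indicator f x)
          (fun i _ => indicator_nonneg (fun y _ => hf0 y) x) (Finset.mem_univ i)

theorem sum_interior_le_overlap_mul (hΩ : IsOpen Ω) (hKΩ : ∀ i, interior (K i) ⊆ Ω)
    (hf : IntegrableOn f Ω) (hf0 : ∀ x, 0 ≤ f x) :
    ∑ i, ∫ x in interior (K i), f x ≤ overlap Ω K * ∫ x in Ω, f x := by
  classical
  have hi : ∀ i, IntegrableOn ((interior (K i)).indicator f) Ω := fun i =>
    hf.indicator isOpen_interior.measurableSet
  have e : ∀ i, ∫ x in interior (K i), f x = ∫ x in Ω, (interior (K i)).indicator f x := fun i => by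
    rw [setIntegral_indicator isOpen_interior.measurableSet, inter_eq_right.2 (hKΩ i)]
  simp only [e]
  rw [← integral_finsetSum _ fun i _ => hi i, ← integral_const_mul]
  refine setIntegral_mono_on (integrable_finsetSum _ fun i _ => hi i) (hf.const_mul _)
    hΩ.measurableSet fun x hx => ?_
  have hle : {i | x ∈ K i}.ncard ≤ overlap Ω K := by
    refine le_ciSup (f := fun x : Ω => {i | (x : E d) ∈ K i}.ncard) ⟨m, ?_⟩ ⟨x, hx⟩
    rintro _ ⟨y, rfl⟩
    simpa using ncard_le_card {i | (y : E d) ∈ K i}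
  calc ∑ i, (interior (K i)).indicator f x ≤ ∑ i, if x ∈ K i then f x else 0 := by
        refine Finset.sum_le_sum fun i _ => ?_
        by_cases h : x ∈ interior (K i)
        · rw [indicator_of_mem h, if_pos (interior_subset h)]
        · rw [indicator_of_notMem h]
          split_ifs
          exacts [hf0 x, le_rfl]
    _ = {i | x ∈ K i}.ncard * f x := by
        rw [← Finset.sum_filter, Finset.sum_const, nsmul_eq_mul, ncard_eq_toFinset_card']
        congr 3
        ext i
        simp
    _ ≤ overlap Ω K * f x := by
        gcongr
        exact hf0 x

end Cover

variable {B K : Fin m → Set (E d)}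

theorem eta_nonneg : 0 ≤ eta B K := by
  unfold eta
  split_ifs
  · exact zero_le_one
  · exact mul_nonneg zero_le_three (Real.iSup_nonneg fun i => by positivity)

theorem bForm_self_nonneg : 0 ≤ bForm B v v := by
  refine Finset.sum_nonneg fun i _ => ?_
  rw [mul_assoc]
  exact mul_nonneg measureReal_nonneg (mul_self_nonneg _)

/-- The local estimate on the convex set `K i`; the null boundary of `K i` is dropped. -/
theorem setIntegral_interior_sq_le (hΩ : IsOpen Ω) (hΩb : Bornology.IsBounded Ω)
    (hBo : ∀ i, IsOpen (B i)) (hBne : ∀ i, (B i).Nonempty) (hK : ∀ i, Convex ℝ (K i))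
    (hKΩ : ∀ i, interior (K i) ⊆ Ω) (hBK : ∀ i, B i ⊆ K i)
    (hv : MemLp v 2 (volume.restrict Ω)) (hg : MemLp g 2 (volume.restrict Ω))
    (hvg : IsWeakGradient Ω v g) (i : Fin m) :
    ∫ x in interior (K i), v x ^ 2 ≤ eta B K *
      (maxDiam K ^ 2 / Real.pi ^ 2 * (∫ x in interior (K i), ‖g x‖ ^ 2) +
        volume.real (B i) * (⨍ x in B i, v x) * (⨍ x in B i, v x)) := by
  have hBint : B i ⊆ interior (K i) := interior_maximal (hBK i) (hBo i)
  have hDne : (interior (K i)).Nonempty := (hBne i).mono hBint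
  have hDb : Bornology.IsBounded (interior (K i)) := hΩb.subset (hKΩ i)
  have hKb : Bornology.IsBounded (K i) := by
    refine Bornology.IsBounded.subset ?_ subset_closure
    rw [← (hK i).closure_interior_eq_closure_of_nonempty_interior hDne]
    exact hDb.closure
  have hdiam : Metric.diam (interior (K i)) ≤ maxDiam K :=
    (Metric.diam_mono interior_subset hKb).trans
      (le_ciSup (f := fun i => Metric.diam (K i)) (finite_range _).bddAbove i)
  have hDfin : volume (interior (K i)) ≠ ⊤ := hDb.measure_lt_top.ne
  have hBpos : 0 < volume.real (B i) :=
    ENNReal.toReal_pos ((hBo i).measure_pos volume (hBne i)).ne'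
      (ne_top_of_le_ne_top hDfin (measure_mono hBint))
  have hres : volume.restrict (interior (K i)) ≤ volume.restrict Ω :=
    Measure.restrict_mono (hKΩ i) le_rfl
  have hP := variance_le_of_isWeakGradient isOpen_interior (hK i).interior hDb hdiam
    (hv.mono_measure hres) (hg.mono_measure hres) (hvg.mono hΩ.measurableSet (hKΩ i))
  rw [mul_left_comm, integral_const, smul_eq_mul, mul_one, measureReal_restrict_apply_univ] at hP
  by_cases heq : ∀ i, B i = K i
  · have hKB : interior (K i) = B i := by rw [← heq i]; exact (hBo i).interior_eq
    rw [eta, if_pos heq, one_mul, hKB]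
    rw [hKB] at hP
    exact setIntegral_sq_le_of_eq hBpos hP
  · rw [eta, if_neg heq]
    refine (setIntegral_sq_le_of_subset hBint
      hBpos hDfin (hv.mono_measure hres) hP).trans ?_
    have hratio : volume.real (interior (K i)) / volume.real (B i) ≤
        ⨆ i, volume.real (K i) / volume.real (B i) :=
      (div_le_div_of_nonneg_right (measureReal_mono interior_subset hKb.measure_lt_top.ne)
        hBpos.le).trans (le_ciSup (f := fun i => volume.real (K i) / volume.real (B i))
          (finite_range _).bddAbove i)
    have h1 : 0 ≤ ∫ x in interior (K i), ‖g x‖ ^ 2 := integral_nonneg fun x => sq_nonneg _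
    have h2 : 0 ≤ volume.real (B i) * (⨍ x in B i, v x) * (⨍ x in B i, v x) := by
      rw [mul_assoc]
      exact mul_nonneg measureReal_nonneg (mul_self_nonneg _)
    gcongr

theorem l2Norm_sq_le (hΩ : IsOpen Ω) (hΩb : Bornology.IsBounded Ω)
    (hBo : ∀ i, IsOpen (B i)) (hBne : ∀ i, (B i).Nonempty) (hK : ∀ i, Convex ℝ (K i))
    (hKΩ : ∀ i, interior (K i) ⊆ Ω) (hBK : ∀ i, B i ⊆ K i) (hcover : Ω ⊆ ⋃ i, closure (K i))
    (hv : MemH1 Ω v) :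
    l2Norm Ω v ^ 2 ≤ eta B K * (maxDiam K ^ 2 * overlap Ω K / Real.pi ^ 2 *
      l2Norm Ω (weakGrad Ω v) ^ 2 + bForm B v v) := by
  obtain ⟨hg, hvg⟩ := weakGrad_spec hv
  have hη : 0 ≤ eta B K := eta_nonneg
  rw [l2Norm_sq hv.1.aestronglyMeasurable, l2Norm_sq hg.aestronglyMeasurable]
  simp only [Real.norm_eq_abs, sq_abs]
  calc ∫ x in Ω, v x ^ 2 ≤ ∑ i, ∫ x in interior (K i), v x ^ 2 :=
        setIntegral_le_sum_interior hΩ hK hKΩ hcover hv.1.integrable_sq fun x => sq_nonneg _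
    _ ≤ ∑ i, eta B K *
        (maxDiam K ^ 2 / Real.pi ^ 2 * (∫ x in interior (K i), ‖weakGrad Ω v x‖ ^ 2) +
          volume.real (B i) * (⨍ x in B i, v x) * (⨍ x in B i, v x)) :=
        Finset.sum_le_sum fun i _ =>
          setIntegral_interior_sq_le hΩ hΩb hBo hBne hK hKΩ hBK hv.1 hg hvg i
    _ = eta B K * (maxDiam K ^ 2 / Real.pi ^ 2 *
        (∑ i, ∫ x in interior (K i), ‖weakGrad Ω v x‖ ^ 2) + bForm B v v) := by
        rw [← Finset.mul_sum, Finset.sum_add_distrib, ← Finset.mul_sum, bForm]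
    _ ≤ eta B K * (maxDiam K ^ 2 / Real.pi ^ 2 *
        (overlap Ω K * ∫ x in Ω, ‖weakGrad Ω v x‖ ^ 2) + bForm B v v) := by
        gcongr
        exact sum_interior_le_overlap_mul hΩ hKΩ (hg.integrable_norm_pow (by norm_num))
          fun x => sq_nonneg _
    _ = _ := by ring

theorem mul_l2Norm_weakGrad_sq_le_aForm {α σ : E d → ℝ} {αmin αmax σmax : ℝ}
    (hα : AEStronglyMeasurable α (volume.restrict Ω))
    (hσ : AEStronglyMeasurable σ (volume.restrict Ω)) (hαmin : 0 < αmin)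
    (hαb : ∀ᵐ x ∂(volume.restrict Ω), αmin ≤ α x ∧ α x ≤ αmax)
    (hσb : ∀ᵐ x ∂(volume.restrict Ω), 0 ≤ σ x ∧ σ x ≤ σmax) (hv : MemH1 Ω v) :
    αmin * l2Norm Ω (weakGrad Ω v) ^ 2 ≤ aForm Ω α σ v v := by
  obtain ⟨hg, -⟩ := weakGrad_spec hv
  have hg2 : Integrable (fun x => ‖weakGrad Ω v x‖ ^ 2) (volume.restrict Ω) :=
    hg.integrable_norm_pow (by norm_num)
  have i1 : Integrable (fun x => α x * ‖weakGrad Ω v x‖ ^ 2) (volume.restrict Ω) := by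
    refine Integrable.bdd_mul (c := αmax) hg2 hα ?_
    filter_upwards [hαb] with x hx
    rw [Real.norm_of_nonneg (hαmin.le.trans hx.1)]
    exact hx.2
  have i2 : Integrable (fun x => σ x * v x ^ 2) (volume.restrict Ω) := by
    refine Integrable.bdd_mul (c := σmax) hv.1.integrable_sq hσ ?_
    filter_upwards [hσb] with x hx
    rw [Real.norm_of_nonneg hx.1]
    exact hx.2
  rw [l2Norm_sq hg.aestronglyMeasurable, ← integral_const_mul, aForm]
  have e : ∀ x, α x * inner ℝ (weakGrad Ω v x) (weakGrad Ω v x) + σ x * v x * v x =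
      α x * ‖weakGrad Ω v x‖ ^ 2 + σ x * v x ^ 2 := fun x => by
    rw [real_inner_self_eq_norm_sq]; ring
  simp only [e]
  refine integral_mono_ae (hg2.const_mul _) (i1.add i2) ?_
  filter_upwards [hαb, hσb] with x h1 h2
  have h3 : αmin * ‖weakGrad Ω v x‖ ^ 2 ≤ α x * ‖weakGrad Ω v x‖ ^ 2 := by gcongr; exact h1.1
  have h4 : 0 ≤ σ x * v x ^ 2 := mul_nonneg h2.1 (sq_nonneg _)
  linarith

end DataPoincare

end

theorem mainTheorem6 {d m : ℕ} (Ω : Set (DataPoincare.E d))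
    (hΩ : IsOpen Ω) (hΩb : Bornology.IsBounded Ω)
    (B K : Fin m → Set (DataPoincare.E d))
    (hBo : ∀ i, IsOpen (B i)) (hBne : ∀ i, (B i).Nonempty) (hBΩ : ∀ i, B i ⊆ Ω)
    (hK : ∀ i, Convex ℝ (K i)) (hKΩ : ∀ i, interior (K i) ⊆ Ω) (hBK : ∀ i, B i ⊆ K i)
    (hcover : Ω ⊆ ⋃ i, closure (K i)) :
    (∀ v : DataPoincare.E d → ℝ, DataPoincare.MemH1 Ω v →
      DataPoincare.l2Norm Ω v ^ 2 ≤
        DataPoincare.eta B K *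
          (DataPoincare.maxDiam K ^ 2 * DataPoincare.overlap Ω K / Real.pi ^ 2 *
              DataPoincare.l2Norm Ω (DataPoincare.weakGrad Ω v) ^ 2 +
            DataPoincare.bForm B v v)) ∧
    (∀ (α σ : DataPoincare.E d → ℝ) (αmin αmax σmax δ : ℝ),
      AEStronglyMeasurable α (volume.restrict Ω) →
      AEStronglyMeasurable σ (volume.restrict Ω) →
      0 < αmin →
      (∀ᵐ x ∂(volume.restrict Ω), αmin ≤ α x ∧ α x ≤ αmax) →
      (∀ᵐ x ∂(volume.restrict Ω), 0 ≤ σ x ∧ σ x ≤ σmax) →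
      0 < δ →
      ∀ v : DataPoincare.E d → ℝ, DataPoincare.MemH1 Ω v →
        DataPoincare.l2Norm Ω v ^ 2 ≤
          DataPoincare.Gam Ω B K αmin δ *
            DataPoincare.formNorm (DataPoincare.cForm Ω B α σ δ) v ^ 2) := by
  have part1 := fun v (hv : DataPoincare.MemH1 Ω v) =>
    DataPoincare.l2Norm_sq_le hΩ hΩb hBo hBne hK hKΩ hBK hcover hv
  refine ⟨part1, fun α σ αmin αmax σmax δ hα hσ hαmin hαb hσb hδ v hv => (part1 v hv).trans ?_⟩
  have hA := DataPoincare.mul_l2Norm_weakGrad_sq_le_aForm hα hσ hαmin hαb hσb hv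
  have hb : 0 ≤ DataPoincare.bForm B v v := DataPoincare.bForm_self_nonneg
  have hT : 0 ≤ αmin * DataPoincare.l2Norm Ω (DataPoincare.weakGrad Ω v) ^ 2 := by positivity
  have hA0 := hT.trans hA
  have hc : 0 ≤ DataPoincare.cForm Ω B α σ δ v v :=
    add_nonneg hA0 (mul_nonneg (inv_nonneg.2 hδ.le) hb)
  rw [DataPoincare.formNorm, Real.sq_sqrt hc, DataPoincare.Gam, DataPoincare.cForm, mul_assoc]
  refine mul_le_mul_of_nonneg_left ?_ DataPoincare.eta_nonneg
  rw [mul_add]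
  refine add_le_add ?_ ?_
  · calc _ = DataPoincare.maxDiam K ^ 2 * DataPoincare.overlap Ω K / (Real.pi ^ 2 * αmin) *
          (αmin * DataPoincare.l2Norm Ω (DataPoincare.weakGrad Ω v) ^ 2) := by
          field_simp
      _ ≤ _ := mul_le_mul (le_max_left _ _) hA hT (hδ.le.trans (le_max_right _ _))
  · calc DataPoincare.bForm B v v = δ * (δ⁻¹ * DataPoincare.bForm B v v) := by
          rw [← mul_assoc, mul_inv_cancel₀ hδ.ne', one_mul]
      _ ≤ _ := mul_le_mul_of_nonneg_right (le_max_right _ _) (mul_nonneg (inv_nonneg.2 hδ.le) hb)
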